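/- **Setting.** Let $\xi$ be a real random variable with mean $0$, variance $1$ and finite sub-Gaussian norm $\|\xi\|_{\psi_2}=\inf\{t>0:\mathbb E\exp(\xi^2/t^2)\le 2\}$, and let $A$ be an $n\times n$ random symmetric matrix whose entries on and above the diagonal are independent copies of $\xi$. For $c_0,c_1\in(0,1)$, let $\operatorname{Comp}(c_0,c_1)$ be the set of unit vectors of $\mathbb R^n$ within Euclidean distance at most $c_1$ of some vector with at most $c_0n$ nonzero coordinates, and let $\operatorname{Incomp}(c_0,c_1)=\mathbb S^{n-1}\setminus\operatorname{Comp}(c_0,c_1)$. Let $c_s\in(0,1/5)$ (a constant attached to $c_0,c_1$), and let $\lambda\in(0,c_s/2)$. To each $v\in\operatorname{Incomp}(c_0,c_1)$ assign a set $\operatorname{Spread}(v)\subseteq[n]$ with $|\operatorname{Spread}(v)|=\lceil c_sn\rceil$ and $$\frac{c_1}{\sqrt{2n}}\le|v_k|\le\frac1{\sqrt{c_0n}}\qquad\text{for all }k\in\operatorname{Spread}(v).$$ Let $T=\lfloor\lceil c_sn\rceil/\lceil\lambda n\rceil\rfloor$, and choose pairwise disjoint sets $\operatorname{Spread}^j_\lambda(v)\subseteq\operatorname{Spread}(v)$,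 $1\le j\le T$, each of size $\lceil\lambda n\rceil$; this choice depends on $v$ only through $\operatorname{Spread}(v)$. For $L\ge1$ and a unit vector $x\in\mathbb R^N$ put $$D_L(x)=\inf\bigl\{\theta>0:\operatorname{dist}(\theta x,\mathbb Z^N)<L\sqrt{\log_+(\theta/L)}\bigr\},\qquad \log_+ = \max(\log,0).$$ The median regularized LCD $\widehat{MD}_L(v,\lambda)$ of $v\in\operatorname{Incomp}(c_0,c_1)$ is the median of the multiset of the $T$ numbers $D_L(v_I/\|v_I\|_2)$, $I=\operatorname{Spread}^j_\lambda(v)$, $1\le j\le T$, where $v_I$ is the restriction of $v$ to the coordinates in $I$ and the median of an even number of elements is the larger of the two middle ones. For $D\ge1$ let $$S_D=\{v\in\operatorname{Incomp}(c_0,c_1):\widehat{MD}_L(v,\lambda)\in[D,2D]\}.$$ **Lemma (small ball for symmetric matrix-vector products).** For every $B\ge 0$ there is $L\ge1$, depending only on $B$; for all $c_0,c_1\in(0,1)$ and $c_s\in(0,1/5)$ there is $c\in(0,c_s/2]$, depending only on $B,c_0,c_1,c_s$; and for every $K\ge1$ there is $C>0$, depending only on $B,c_0,c_1,c_s,K$,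 such that the following holds for every $\xi$ as above with $\|\xi\|_{\psi_2}\le B$ and every $n$. Let $\lambda\in(C/n,c)$, fix any choice of the sets $\operatorname{Spread}(v)$ and $\operatorname{Spread}^j_\lambda(v)$ as above, let $D\ge1$, $v\in S_D$ (defined with respect to $\lambda$, $L$ and this choice) and $u\in\mathbb R^n$. Then $$\mathbb P\bigl[\|Av-u\|_2\le K\beta\sqrt n\bigr]\le\left(\frac{CL^2\sqrt{\log(2D)}}{D}\right)^{n-\lceil\lambda n\rceil},\qquad\text{where }\beta=\frac{L\sqrt{\log(2D)}}{D}.$$ -/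

import Mathlib

open MeasureTheory ProbabilityTheory
open scoped NNReal ENNReal

noncomputable section

namespace SmallBall

/-- The sub-Gaussian (`ψ₂`) norm `inf {t > 0 : 𝔼 exp (ξ² / t²) ≤ 2}` of a random variable;
it is `∞` when `ξ` is not sub-Gaussian. -/
def subGaussianNorm {Ω : Type*} [MeasurableSpace Ω] (ξ : Ω → ℝ) (P : Measure Ω) : ℝ≥0∞ :=
  ⨅ t ∈ {t : ℝ | 0 < t ∧ ∫⁻ ω, ENNReal.ofReal (Real.exp (ξ ω ^ 2 / t ^ 2)) ∂P ≤ 2},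
    ENNReal.ofReal t

/-- `A` is a random symmetric matrix whose entries on and above the diagonal are independent
copies of `ξ`. -/
structure IsSymmetricRandomMatrix {Ω Ω' : Type*} [MeasurableSpace Ω] [MeasurableSpace Ω']
    {n : ℕ} (A : Ω → Matrix (Fin n) (Fin n) ℝ) (μ : Measure Ω)
    (ξ : Ω' → ℝ) (P : Measure Ω') : Prop where
  isSymm : ∀ ω, (A ω).IsSymm
  indep : iIndepFun
    (fun (p : {p : Fin n × Fin n // p.1 ≤ p.2}) (ω : Ω) => A ω p.1.1 p.1.2) μ
  identDistrib : ∀ i j : Fin n, i ≤ j → IdentDistrib (fun ω => A ω i j) ξ μ P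

/-- Compressible unit vectors: within distance `c₁` of a vector with at most `c₀ n` nonzero
coordinates. -/
def Comp (n : ℕ) (c₀ c₁ : ℝ) : Set (EuclideanSpace ℝ (Fin n)) :=
  {v | ‖v‖ = 1 ∧ ∃ w : EuclideanSpace ℝ (Fin n),
    ({k : Fin n | w k ≠ 0}.ncard : ℝ) ≤ c₀ * n ∧ ‖v - w‖ ≤ c₁}

/-- Incompressible unit vectors. -/
def Incomp (n : ℕ) (c₀ c₁ : ℝ) : Set (EuclideanSpace ℝ (Fin n)) :=
  {v | ‖v‖ = 1} \ Comp n c₀ c₁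

/-- The number `T` of blocks of size `⌈lam n⌉`: `T ⌈lam n⌉` is the largest multiple of
`⌈lam n⌉` which is at most `⌈cs n⌉`. -/
def blockCount (n : ℕ) (cs lam : ℝ) : ℕ := ⌈cs * n⌉₊ / ⌈lam * n⌉₊

/-- A choice of the spread sets `Spread(v)`, and of the blocks `Spread_lam^j`, `j < T`. The
blocks are functions of the spread set alone; their union is `Spread_lam(v)`. -/
structure SpreadChoice (n : ℕ) (c₀ c₁ cs lam : ℝ) where
  /-- The set `Spread(v)`. -/
  spread : EuclideanSpace ℝ (Fin n) → Finset (Fin n)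
  card_spread : ∀ v ∈ Incomp n c₀ c₁, (spread v).card = ⌈cs * n⌉₊
  spread_bounds : ∀ v ∈ Incomp n c₀ c₁, ∀ k ∈ spread v,
    c₁ / √(2 * n) ≤ |v k| ∧ |v k| ≤ 1 / √(c₀ * n)
  /-- The `j`-th block of a set `S` that is to be partitioned. -/
  block : Finset (Fin n) → Fin (blockCount n cs lam) → Finset (Fin n)
  block_subset : ∀ S : Finset (Fin n), S.card = ⌈cs * n⌉₊ → ∀ j, block S j ⊆ S
  card_block : ∀ S : Finset (Fin n), S.card = ⌈cs * n⌉₊ → ∀ j, (block S j).card = ⌈lam * n⌉₊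
  block_disjoint : ∀ S : Finset (Fin n), S.card = ⌈cs * n⌉₊ →
    Pairwise fun i j => Disjoint (block S i) (block S j)

/-- The log-normalized least common denominator `D_L(x)`; `Real.posLog` is
`log₊ = max (log ·) 0`. -/
def lcd {ι : Type*} [Fintype ι] (L : ℝ) (x : EuclideanSpace ℝ ι) : ℝ :=
  sInf {θ : ℝ | 0 < θ ∧
    Metric.infDist (θ • x) {z : EuclideanSpace ℝ ι | ∀ i, ∃ m : ℤ, z i = m}
      < L * √(Real.posLog (θ / L))}

/-- The coordinate restriction `v_I`. -/
def restrictCoords {n : ℕ} (v : EuclideanSpace ℝ (Fin n)) (I : Finset (Fin n)) :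
    EuclideanSpace ℝ I :=
  WithLp.toLp 2 fun i => v i

/-- The median of a finite family of reals, the upper one of the two middle values if the number
of members is even: the entry of index `T / 2`, counted from `0`, in increasing order.
(The value for the empty family is irrelevant.) -/
def upperMedian {T : ℕ} (f : Fin T → ℝ) : ℝ :=
  if h : 0 < T then f (Tuple.sort f ⟨T / 2, Nat.div_lt_self h one_lt_two⟩) else 0

/-- The median regularized LCD of `v`. -/
def mrlcd {n : ℕ} {c₀ c₁ cs lam : ℝ} (S : SpreadChoice n c₀ c₁ cs lam) (L : ℝ)
    (v : EuclideanSpace ℝ (Fin n)) : ℝ :=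
  upperMedian fun j =>
    lcd L (‖restrictCoords v (S.block (S.spread v) j)‖⁻¹ •
      restrictCoords v (S.block (S.spread v) j))

/-- The level set `S_D` of the median regularized LCD. -/
def levelSet {n : ℕ} {c₀ c₁ cs lam : ℝ} (S : SpreadChoice n c₀ c₁ cs lam) (L D : ℝ) :
    Set (EuclideanSpace ℝ (Fin n)) :=
  {v | v ∈ Incomp n c₀ c₁ ∧ mrlcd S L v ∈ Set.Icc D (2 * D)}

end SmallBall

end

/-! By an exponential Markov inequality, the probability is at most `exp (K² n / 2)` times the
expectation of the product of the Gaussian weights `exp (-((Av - u)_k / β)² / 2)` over any chosen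
set of rows.

Symmetry makes the rows dependent. At least half of the blocks of `v` have LCD at least `D`; call
`m` of them `G 0, …, G (m - 1)`. A coordinate in `G j` gets level `j`, a coordinate outside these
blocks gets level `m`. Rows are integrated in increasing order of level, row `k` only over its
entries in columns of strictly lower level. By symmetry such an entry also lies in the row of its
column, but that row has lower level: it is already integrated or was discarded
(`lintegral_prod_rowValue_le`).

A row of level `ℓ ≥ 1` thus uses the `ℓ` blocks `G 0, …, G (ℓ - 1)`. In Fourier variables the frozen
entries only contribute a phase. Jensen's inequality reduces the union of blocks to one block with
exponent multiplied by `ℓ` (`integral_prod_charFun_le`), and the LCD bound turns this into a factor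
of order `L β / √(lam ℓ)` (`integral_block_le`). So `ℓ` blocks gain `√ℓ` over one.

Level `0` rows have no fresh entries and are dropped; this gives the exponent `n - ⌈lam n⌉`. Since
`lam m` is bounded below, replacing each `ℓ` by `m` costs at most `(m ^ m / m!) ^ (N / 2) ≤ exp (n /
2)`, where `N` is the block size (`prod_div_level_le`). Hence no power of `lam` is lost, and
exponential factors are absorbed into `C`. -/

noncomputable section

namespace SmallBall

/-! ### Distance to the integers and decay of characteristic functions -/

/-- The distance from a real number to the nearest integer. -/
def distInt (x : ℝ) : ℝ := |x - round x|

lemma distInt_eq_norm (x : ℝ) : distInt x = ‖(x : UnitAddCircle)‖ :=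
  UnitAddCircle.norm_eq.symm

lemma continuous_distInt : Continuous distInt := by
  have : distInt = fun x : ℝ => ‖(x : UnitAddCircle)‖ := funext distInt_eq_norm
  rw [this]
  exact continuous_norm.comp (AddCircle.continuous_mk' 1)

lemma distInt_nonneg (x : ℝ) : 0 ≤ distInt x := abs_nonneg _

lemma distInt_le_half (x : ℝ) : distInt x ≤ 1 / 2 := abs_sub_round x

lemma distInt_of_abs_lt {x : ℝ} (hx : |x| < 1 / 2) : distInt x = |x| := by
  have : round x = 0 := by
    rw [round_eq_zero_iff]
    rw [abs_lt] at hx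
    constructor <;> linarith [hx.1, hx.2]
  simp [distInt, this]

lemma distInt_neg (x : ℝ) : distInt (-x) = distInt x := by
  rw [distInt_eq_norm, distInt_eq_norm, AddCircle.coe_neg, norm_neg]

lemma distInt_abs (x : ℝ) : distInt |x| = distInt x := by
  rcases abs_choice x with h | h <;> rw [h]
  exact distInt_neg x

lemma distInt_sq_le_one (x : ℝ) : distInt x ^ 2 ≤ 1 := by
  nlinarith [distInt_nonneg x, distInt_le_half x]

lemma cos_two_pi_mul_le (x : ℝ) : Real.cos (2 * Real.pi * x) ≤ 1 - 8 * distInt x ^ 2 := by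
  have h1 : Real.cos (2 * Real.pi * x) = Real.cos (2 * Real.pi * (x - round x)) := by
    rw [mul_sub, ← Real.cos_sub_int_mul_two_pi _ (round x)]
    congr 1; ring
  have h2 := Real.cos_le_one_sub_mul_cos_sq (x := 2 * Real.pi * (x - round x)) (by
    rw [abs_mul, abs_of_pos Real.two_pi_pos]
    nlinarith [abs_sub_round x, Real.pi_pos])
  rw [h1]
  refine h2.trans_eq ?_
  rw [distInt, sq_abs]
  field_simp
  ring

lemma norm_charFun_sq (ν : Measure ℝ) [IsProbabilityMeasure ν] (t : ℝ) :
    ‖charFun ν t‖ ^ 2 = ∫ p : ℝ × ℝ, Real.cos (t * (p.1 - p.2)) ∂(ν.prod ν) := by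
  have h1 : ((‖charFun ν t‖ ^ 2 : ℝ) : ℂ) = charFun ν t * charFun ν (-t) := by
    rw [charFun_neg, Complex.mul_conj, Complex.normSq_eq_norm_sq]
  have h2 : charFun ν t * charFun ν (-t)
      = ∫ p : ℝ × ℝ, Complex.exp (((t * (p.1 - p.2) : ℝ) : ℂ) * Complex.I) ∂(ν.prod ν) := by
    rw [charFun_apply_real, charFun_apply_real, ← integral_prod_mul]
    congr 1; ext p
    rw [← Complex.exp_add]
    congr 1; push_cast; ring
  have hint : Integrable (fun p : ℝ × ℝ =>
      Complex.exp (((t * (p.1 - p.2) : ℝ) : ℂ) * Complex.I)) (ν.prod ν) := by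
    refine Integrable.of_bound (C := 1) (by fun_prop) (Filter.Eventually.of_forall fun p => ?_)
    rw [Complex.norm_exp_ofReal_mul_I]
  have h3 := congrArg Complex.re (h1.trans h2)
  rw [Complex.ofReal_re] at h3
  rw [h3, ← RCLike.re_eq_complex_re, ← integral_re hint]
  congr 1; ext p
  rw [RCLike.re_eq_complex_re, Complex.exp_ofReal_mul_I_re]

lemma integrable_distInt_sq {α : Type*} [MeasurableSpace α] (κ : Measure α) [IsFiniteMeasure κ]
    {f : α → ℝ} (hf : Measurable f) : Integrable (fun p => distInt (f p) ^ 2) κ := by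
  refine Integrable.of_bound (C := 1)
    (((continuous_distInt.measurable.comp hf).pow_const 2).aestronglyMeasurable)
    (Filter.Eventually.of_forall fun p => ?_)
  rw [Real.norm_of_nonneg (by positivity)]
  exact distInt_sq_le_one _

/-- The squared modulus is the characteristic function of the symmetrized variable, an average of
cosines. The quadratic bound on the cosine and `1 - 8 J ≤ exp (-8 J)` then give the claim after a
square root. -/
lemma norm_charFun_le_exp (ν : Measure ℝ) [IsProbabilityMeasure ν] (t : ℝ) :
    ‖charFun ν t‖ ≤ Real.exp (-4 * ∫ p : ℝ × ℝ,
      distInt (t * (p.1 - p.2) / (2 * Real.pi)) ^ 2 ∂(ν.prod ν)) := by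
  set J := ∫ p : ℝ × ℝ, distInt (t * (p.1 - p.2) / (2 * Real.pi)) ^ 2 ∂(ν.prod ν) with hJ
  have hi : Integrable (fun p : ℝ × ℝ => distInt (t * (p.1 - p.2) / (2 * Real.pi)) ^ 2)
      (ν.prod ν) := integrable_distInt_sq _ (by fun_prop)
  have h1 : ‖charFun ν t‖ ^ 2 ≤ 1 - 8 * J := by
    rw [norm_charFun_sq, hJ]
    calc _ ≤ ∫ p : ℝ × ℝ, (1 - 8 * distInt (t * (p.1 - p.2) / (2 * Real.pi)) ^ 2)
          ∂(ν.prod ν) := by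
          refine integral_mono ?_ ((integrable_const _).sub (hi.const_mul 8)) fun p => ?_
          · refine Integrable.of_bound (C := 1) (by fun_prop)
              (Filter.Eventually.of_forall fun p => ?_)
            exact Real.abs_cos_le_one _
          · refine le_trans (le_of_eq ?_) (cos_two_pi_mul_le _)
            congr 1; field_simp
      _ = _ := by
          rw [integral_sub (integrable_const _) (hi.const_mul 8), integral_const_mul]
          simp
  have h2 : ‖charFun ν t‖ ^ 2 ≤ Real.exp (-4 * J) ^ 2 := by
    rw [← Real.exp_nat_mul]
    refine h1.trans ?_
    have := Real.add_one_le_exp (-8 * J)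
    push_cast
    rw [show (2 : ℝ) * (-4 * J) = -8 * J by ring]
    linarith
  exact le_of_sq_le_sq h2 (Real.exp_pos _).le

/-! ### Gaussian smoothing and reduction to single blocks -/

lemma exp_neg_sq_eq_integral {β : ℝ} (x : ℝ) :
    ((Real.exp (-(x / β) ^ 2 / 2) : ℝ) : ℂ)
      = ∫ s : ℝ, Complex.exp (((s * (x / β) : ℝ) : ℂ) * Complex.I) ∂(gaussianReal 0 1) := by
  have := charFun_gaussianReal (μ := 0) (v := 1) (t := x / β)
  rw [charFun_apply_real] at this
  rw [show (fun s : ℝ => Complex.exp (((s * (x / β) : ℝ) : ℂ) * Complex.I))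
    = fun s : ℝ => Complex.exp (((x / β : ℝ) : ℂ) * s * Complex.I) by
      ext s; congr 1; push_cast; ring, this]
  push_cast
  congr 1
  simp
  ring

/-- The Gaussian-smoothed small ball probability of a sum of independent variables is at most the
Gaussian average of the modulus of the characteristic function. -/
lemma integral_exp_neg_sq_le {ι : Type*} [Fintype ι] (ν : Measure ℝ) [IsProbabilityMeasure ν]
    (w : ι → ℝ) (y β : ℝ) :
    ∫ a : ι → ℝ, Real.exp (-((∑ i, w i * a i + y) / β) ^ 2 / 2) ∂(Measure.pi fun _ => ν)
      ≤ ∫ s, ∏ i, ‖charFun ν (s * w i / β)‖ ∂(gaussianReal 0 1) := by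
  have key : ((∫ a : ι → ℝ, Real.exp (-((∑ i, w i * a i + y) / β) ^ 2 / 2)
        ∂(Measure.pi fun _ => ν) : ℝ) : ℂ)
      = ∫ s : ℝ, Complex.exp (((s * (y / β) : ℝ) : ℂ) * Complex.I)
          * ∏ i, charFun ν (s * w i / β) ∂(gaussianReal 0 1) := by
    rw [← integral_complex_ofReal]
    simp_rw [exp_neg_sq_eq_integral]
    rw [integral_integral_swap]
    · congr 1; ext s
      simp_rw [charFun_apply_real]
      rw [← integral_fintype_prod_eq_prod, ← integral_const_mul]
      congr 1; ext a
      rw [← Complex.exp_sum, ← Complex.exp_add]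
      congr 1
      rw [← Finset.sum_mul, ← add_mul]
      congr 1
      push_cast
      rw [add_div, mul_add, Finset.sum_div, Finset.mul_sum, add_comm]
      congr 1
      exact Finset.sum_congr rfl fun i _ => by ring
    · refine Integrable.of_bound (C := 1) ?_ (Filter.Eventually.of_forall fun p => ?_)
      · refine Measurable.aestronglyMeasurable ?_
        simp only [Function.uncurry_def]
        fun_prop
      · simp only [Function.uncurry_def]
        rw [Complex.norm_exp_ofReal_mul_I]
  refine le_trans (le_abs_self _) ?_
  rw [← Real.norm_eq_abs, ← Complex.norm_real, key]
  refine (norm_integral_le_integral_norm _).trans_eq ?_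
  congr 1; ext s
  rw [norm_mul, Complex.norm_exp_ofReal_mul_I, one_mul, norm_prod]

/-- Jensen's inequality combined with Fubini: a Gaussian average of a product of characteristic
functions over a union of blocks is controlled by the worst single block. -/
lemma integral_prod_charFun_le {ι κ : Type*} [DecidableEq ι] (ν : Measure ℝ)
    [IsProbabilityMeasure ν] (R : Set (ℝ × ℝ)) (hR : MeasurableSet R)
    (hq : 0 < (ν.prod ν).real R) (w : ι → ℝ) (J : Finset κ) (hJ : J.Nonempty)
    (I : κ → Finset ι) (hI : Set.PairwiseDisjoint (↑J) I) (p : ℝ)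
    (hp : ∀ j ∈ J, ∀ z ∈ R, ∫ s, Real.exp (-4 * (ν.prod ν).real R * J.card *
      ∑ i ∈ I j, distInt (s * w i * (z.1 - z.2) / (2 * Real.pi)) ^ 2) ∂(gaussianReal 0 1) ≤ p) :
    ∫ s, ∏ i ∈ J.biUnion I, ‖charFun ν (s * w i)‖ ∂(gaussianReal 0 1) ≤ p := by
  set q := (ν.prod ν).real R with hqdef
  set ℓ : ℝ := (J.card : ℝ) with hℓ
  have hℓ0 : 0 < ℓ := by simpa [hℓ] using hJ
  set Q : κ → ℝ → ℝ × ℝ → ℝ := fun j s z =>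
    ∑ i ∈ I j, distInt (s * w i * (z.1 - z.2) / (2 * Real.pi)) ^ 2 with hQ
  have hmeas : ∀ j, Measurable fun y : ℝ × (ℝ × ℝ) => Q j y.1 y.2 := by
    intro j
    simp only [hQ]
    refine Finset.measurable_sum _ fun i _ => ?_
    exact (continuous_distInt.measurable.comp (by fun_prop)).pow_const 2
  have hQ0 : ∀ j s z, 0 ≤ Q j s z := fun j s z => Finset.sum_nonneg fun i _ => sq_nonneg _
  have hexp1 : ∀ j s z, ‖Real.exp (-4 * q * ℓ * Q j s z)‖ ≤ 1 := by
    intro j s z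
    rw [Real.norm_of_nonneg (Real.exp_pos _).le, Real.exp_le_one_iff]
    have := mul_nonneg (mul_pos hq hℓ0).le (hQ0 j s z)
    linarith
  have hmeasE : ∀ j, Measurable fun y : ℝ × (ℝ × ℝ) => Real.exp (-4 * q * ℓ * Q j y.1 y.2) :=
    fun j => Real.measurable_exp.comp ((hmeas j).const_mul _)
  have hQi : ∀ j s, Integrable (Q j s) (ν.prod ν) := fun j s =>
    integrable_finsetSum _ fun i _ => integrable_distInt_sq _ (by fun_prop)
  have hEi : ∀ j, ∀ s, IntegrableOn (fun z => Real.exp (-4 * q * ℓ * Q j s z)) R (ν.prod ν) :=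
    fun j s => Integrable.of_bound (C := 1)
      ((hmeasE j).comp measurable_prodMk_left).aestronglyMeasurable
      (Filter.Eventually.of_forall fun z => hexp1 j s z)
  have hR0 : (ν.prod ν) R ≠ 0 := by
    intro h
    rw [hqdef, measureReal_def, h] at hq
    simp at hq
  have hEp : ∀ j, Integrable (fun y : ℝ × (ℝ × ℝ) => Real.exp (-4 * q * ℓ * Q j y.1 y.2))
      ((gaussianReal 0 1).prod ((ν.prod ν).restrict R)) := fun j =>
    Integrable.of_bound (C := 1) (hmeasE j).aestronglyMeasurable
      (Filter.Eventually.of_forall fun z => hexp1 j _ _)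
  have hpt : ∀ s, ∏ i ∈ J.biUnion I, ‖charFun ν (s * w i)‖
      ≤ ∑ j ∈ J, ℓ⁻¹ * (q⁻¹ * ∫ z in R, Real.exp (-4 * q * ℓ * Q j s z) ∂(ν.prod ν)) := by
    intro s
    calc ∏ i ∈ J.biUnion I, ‖charFun ν (s * w i)‖
        ≤ ∏ i ∈ J.biUnion I, Real.exp (-4 * ∫ z : ℝ × ℝ,
            distInt (s * w i * (z.1 - z.2) / (2 * Real.pi)) ^ 2 ∂(ν.prod ν)) :=
          Finset.prod_le_prod (fun i _ => norm_nonneg _) fun i _ => norm_charFun_le_exp ν _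
      _ = Real.exp (∑ j ∈ J, -4 * ∫ z, Q j s z ∂(ν.prod ν)) := by
          rw [← Real.exp_sum, Finset.sum_biUnion hI]
          congr 1
          refine Finset.sum_congr rfl fun j _ => ?_
          rw [← Finset.mul_sum, integral_finsetSum _ fun i _ =>
            integrable_distInt_sq _ (by fun_prop)]
      _ ≤ Real.exp (∑ j ∈ J, ℓ⁻¹ • ⨍ z in R, -4 * q * ℓ * Q j s z ∂(ν.prod ν)) := by
          refine Real.exp_le_exp.2 (Finset.sum_le_sum fun j _ => ?_)
          rw [setAverage_eq, integral_const_mul, ← hqdef, smul_eq_mul, smul_eq_mul]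
          have h1 : ∫ z in R, Q j s z ∂(ν.prod ν) ≤ ∫ z, Q j s z ∂(ν.prod ν) :=
            setIntegral_le_integral (hQi j s) (Filter.Eventually.of_forall (hQ0 j s))
          have h2 : ℓ⁻¹ * (q⁻¹ * (-4 * q * ℓ * ∫ z in R, Q j s z ∂(ν.prod ν)))
              = -4 * ∫ z in R, Q j s z ∂(ν.prod ν) := by
            field_simp
          rw [h2]
          linarith
      _ ≤ ∑ j ∈ J, ℓ⁻¹ • Real.exp (⨍ z in R, -4 * q * ℓ * Q j s z ∂(ν.prod ν)) := by
          refine convexOn_exp.map_sum_le (fun _ _ => by positivity) ?_ (fun _ _ => trivial)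
          rw [Finset.sum_const, nsmul_eq_mul, ← hℓ]
          field_simp
      _ ≤ _ := by
          refine Finset.sum_le_sum fun j _ => ?_
          rw [smul_eq_mul]
          refine mul_le_mul_of_nonneg_left ?_ (by positivity)
          refine (convexOn_exp.map_set_average_le Real.continuous_exp.continuousOn isClosed_univ
            hR0 (measure_ne_top _ _) (by simp) ((hQi j s).integrableOn.const_mul _)
            (hEi j s)).trans_eq ?_
          rw [setAverage_eq, smul_eq_mul]
  have hgi : ∀ j, Integrable (fun s => ∫ z in R, Real.exp (-4 * q * ℓ * Q j s z) ∂(ν.prod ν))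
      (gaussianReal 0 1) := fun j => (hEp j).integral_prod_left
  calc ∫ s, ∏ i ∈ J.biUnion I, ‖charFun ν (s * w i)‖ ∂(gaussianReal 0 1)
      ≤ ∫ s, ∑ j ∈ J, ℓ⁻¹ * (q⁻¹ * ∫ z in R, Real.exp (-4 * q * ℓ * Q j s z) ∂(ν.prod ν))
          ∂(gaussianReal 0 1) := by
        refine integral_mono_of_nonneg (Filter.Eventually.of_forall fun s =>
          Finset.prod_nonneg fun i _ => norm_nonneg _) ?_ (Filter.Eventually.of_forall hpt)
        exact integrable_finsetSum _ fun j _ => ((hgi j).const_mul _).const_mul _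
    _ = ∑ j ∈ J, ℓ⁻¹ * (q⁻¹ * ∫ z in R, ∫ s, Real.exp (-4 * q * ℓ * Q j s z)
          ∂(gaussianReal 0 1) ∂(ν.prod ν)) := by
        rw [integral_finsetSum _ fun j _ => ((hgi j).const_mul _).const_mul _]
        refine Finset.sum_congr rfl fun j _ => ?_
        rw [integral_const_mul, integral_const_mul, integral_integral_swap (hEp j)]
    _ ≤ ∑ j ∈ J, ℓ⁻¹ * (q⁻¹ * (q * p)) := by
        refine Finset.sum_le_sum fun j hj => ?_
        refine mul_le_mul_of_nonneg_left (mul_le_mul_of_nonneg_left ?_ (by positivity))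
          (by positivity)
        calc _ ≤ ∫ z in R, p ∂(ν.prod ν) := by
              refine setIntegral_mono_on ?_ (integrable_const p).integrableOn hR (hp j hj)
              exact (hEp j).integral_prod_right
          _ = q * p := by rw [setIntegral_const, smul_eq_mul]
    _ = p := by
        rw [Finset.sum_const, nsmul_eq_mul, ← hℓ]
        field_simp

/-! ### Integral over one block with large LCD -/

/-- For `θ ≤ 2 L` all `θ x i` are at most `1/4` in modulus, so no rounding occurs and the sum equals
`θ²`. For `2 L < θ < D` the logarithmic lower bound makes the exponential at most `(θ / L) ^ (-2
ℓ)`, and Bernoulli's inequality brings this to the same rational form. Keeping `ℓ` inside the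
denominator is what yields the gain `1 / √ℓ` after integration. -/
lemma exp_neg_sum_distInt_le {ι : Type*} (I : Finset ι) (x : ι → ℝ) {L q D θ : ℝ} {ℓ : ℕ}
    (hL : 0 < L) (hq : 2 ≤ 4 * q * L ^ 2) (hℓ : 1 ≤ ℓ) (hx1 : ∑ i ∈ I, x i ^ 2 = 1)
    (hx : ∀ i ∈ I, |x i| ≤ 1 / (8 * L))
    (hD : ∀ t, 0 < t → t < D → L ^ 2 * Real.log (t / L) ≤ ∑ i ∈ I, distInt (t * x i) ^ 2)
    (hθ : 0 ≤ θ) (hθD : θ < D) :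
    Real.exp (-4 * q * ℓ * ∑ i ∈ I, distInt (θ * x i) ^ 2)
      ≤ (1 + ℓ * θ ^ 2 / (2 * L ^ 2))⁻¹ := by
  have hℓ' : (1 : ℝ) ≤ ℓ := by exact_mod_cast hℓ
  have hq0 : 0 < q := by
    by_contra h
    push Not at h
    nlinarith [sq_nonneg L]
  have hqL : 2 / L ^ 2 ≤ 4 * q := by rwa [div_le_iff₀ (by positivity)]
  set N := ∑ i ∈ I, distInt (θ * x i) ^ 2 with hN
  rw [show -4 * q * ℓ * N = -(4 * q * ℓ * N) by ring, Real.exp_neg]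
  refine inv_anti₀ (by positivity) ?_
  rcases le_or_gt θ (2 * L) with h | h
  · have hNθ : N = θ ^ 2 := by
      rw [hN, ← mul_one (θ ^ 2), ← hx1, Finset.mul_sum]
      refine Finset.sum_congr rfl fun i hi => ?_
      rw [distInt_of_abs_lt, sq_abs, mul_pow]
      rw [abs_mul, abs_of_nonneg hθ]
      calc θ * |x i| ≤ 2 * L * (1 / (8 * L)) := by
            gcongr
            exact hx i hi
        _ = 1 / 4 := by field_simp; norm_num
        _ < 1 / 2 := by norm_num
    rw [hNθ]
    refine le_trans ?_ (Real.add_one_le_exp _)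
    have : ℓ * θ ^ 2 / (2 * L ^ 2) ≤ 4 * q * ℓ * θ ^ 2 := by
      calc ℓ * θ ^ 2 / (2 * L ^ 2) ≤ 2 / L ^ 2 * (ℓ * θ ^ 2) := by
            rw [div_mul_eq_mul_div, div_le_div_iff₀ (by positivity) (by positivity)]
            have : 0 ≤ ℓ * θ ^ 2 * L ^ 2 := by positivity
            nlinarith
        _ ≤ 4 * q * (ℓ * θ ^ 2) := by gcongr
        _ = _ := by ring
    linarith
  · have hθ0 : 0 < θ := by linarith
    have h2 : 2 < θ / L := by rwa [lt_div_iff₀ hL]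
    have hlog : 0 < Real.log (θ / L) := Real.log_pos (by linarith)
    have h3 : (2 * ℓ : ℝ) * Real.log (θ / L) ≤ 4 * q * ℓ * N := by
      calc (2 * ℓ : ℝ) * Real.log (θ / L) ≤ (4 * q * L ^ 2) * ℓ * Real.log (θ / L) := by gcongr
        _ = 4 * q * ℓ * (L ^ 2 * Real.log (θ / L)) := by ring
        _ ≤ _ := by
          gcongr
          exact hD θ hθ0 hθD
    refine le_trans ?_ (Real.exp_le_exp.2 h3)
    have h4 : Real.exp (2 * ℓ * Real.log (θ / L)) = ((θ / L) ^ 2) ^ ℓ := by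
      rw [← pow_mul, ← Real.exp_log (show 0 < θ / L by positivity), ← Real.exp_nat_mul,
        Real.log_exp]
      push_cast
      ring_nf
    rw [h4]
    have h5 := one_add_mul_le_pow (a := (θ / L) ^ 2 - 1) (by nlinarith) ℓ
    rw [add_sub_cancel] at h5
    refine le_trans ?_ h5
    have h6 : ℓ * θ ^ 2 / (2 * L ^ 2) = ℓ * ((θ / L) ^ 2 / 2) := by field_simp
    rw [h6]
    gcongr
    nlinarith

lemma le_sum_distInt_of_le_lcd {ι : Type*} [Fintype ι] {L D : ℝ} (hL : 0 < L)
    {x : EuclideanSpace ℝ ι} (hD : D ≤ lcd L x) {t : ℝ} (ht : 0 < t) (htD : t < D) :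
    L ^ 2 * Real.log (t / L) ≤ ∑ i, distInt (t * x i) ^ 2 := by
  have h1 : L * √(Real.posLog (t / L))
      ≤ Metric.infDist (t • x) {z : EuclideanSpace ℝ ι | ∀ i, ∃ m : ℤ, z i = m} := by
    by_contra! h
    have : lcd L x ≤ t := csInf_le ⟨0, fun y hy => hy.1.le⟩ ⟨ht, h⟩
    linarith
  have h2 : Metric.infDist (t • x) {z : EuclideanSpace ℝ ι | ∀ i, ∃ m : ℤ, z i = m}
      ≤ √(∑ i, distInt (t * x i) ^ 2) := by
    refine (Metric.infDist_le_dist_of_mem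
      (y := WithLp.toLp 2 fun i => (round (t * x i) : ℝ)) fun i => ⟨_, rfl⟩).trans_eq ?_
    rw [EuclideanSpace.dist_eq]
    rfl
  have h3 : (L * √(Real.posLog (t / L))) ^ 2 ≤ ∑ i, distInt (t * x i) ^ 2 := by
    rw [← Real.sq_sqrt (Finset.sum_nonneg fun i _ => sq_nonneg (distInt (t * x i)))]
    exact pow_le_pow_left₀ (by positivity) (h1.trans h2) 2
  rw [mul_pow, Real.sq_sqrt Real.posLog_nonneg] at h3
  refine le_trans ?_ h3
  gcongr
  exact le_max_right _ _

/-- The Cauchy-type bound is integrated where `k |s| < D`. Elsewhere `hkD` forces `s² ≥ 4 log (2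
D)`, and half of the Gaussian exponent already pays for the factor `1 / (2 D)`. -/
lemma integral_gaussianReal_le_of_le_inv {f : ℝ → ℝ} (hf0 : ∀ s, 0 ≤ f s) (hf1 : ∀ s, f s ≤ 1)
    {α k D : ℝ} (hα : 0 < α) (hk : 0 < k) (hD : 1 ≤ D)
    (hkD : 2 * √(Real.log (2 * D)) ≤ D / k)
    (hf : ∀ s, k * |s| < D → f s ≤ (1 + (α * s) ^ 2)⁻¹) :
    ∫ s, f s ∂(gaussianReal 0 1) ≤ 2 / α + 1 / D := by
  have hD0 : 0 < D := by linarith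
  have hlog : 0 ≤ Real.log (2 * D) := Real.log_nonneg (by linarith)
  rw [integral_gaussianReal_eq_integral_smul (by norm_num)]
  have hi1 : Integrable fun s : ℝ => (1 + (α * s) ^ 2)⁻¹ :=
    integrable_inv_one_add_sq.comp_mul_left' hα.ne'
  have hi2 : Integrable fun s : ℝ => (1 / (2 * D)) * Real.exp (-(1 / 4) * s ^ 2) :=
    (integrable_exp_neg_mul_sq (by norm_num)).const_mul _
  have hpdf : ∀ s, gaussianPDFReal 0 1 s ≤ 1 / 2 * Real.exp (-s ^ 2 / 2) := by
    intro s
    rw [gaussianPDFReal]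
    simp only [NNReal.coe_one, mul_one, sub_zero]
    gcongr
    rw [← one_div]
    refine one_div_le_one_div_of_le (by norm_num) (Real.le_sqrt_of_sq_le ?_)
    nlinarith [Real.pi_gt_three]
  have hpt : ∀ s, gaussianPDFReal 0 1 s • f s
      ≤ 1 / 2 * ((1 + (α * s) ^ 2)⁻¹ + (1 / (2 * D)) * Real.exp (-(1 / 4) * s ^ 2)) := by
    intro s
    rw [smul_eq_mul]
    have h0 : gaussianPDFReal 0 1 s * f s ≤ 1 / 2 * Real.exp (-s ^ 2 / 2) * f s :=
      mul_le_mul_of_nonneg_right (hpdf s) (hf0 s)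
    refine h0.trans ?_
    rw [mul_assoc]
    refine mul_le_mul_of_nonneg_left ?_ (by norm_num)
    rcases lt_or_ge (k * |s|) D with h | h
    · have h1 : Real.exp (-s ^ 2 / 2) * f s ≤ 1 * (1 + (α * s) ^ 2)⁻¹ := by
        refine mul_le_mul ?_ (hf s h) (hf0 s) (by norm_num)
        rw [Real.exp_le_one_iff]
        nlinarith [sq_nonneg s]
      have h2 : 0 ≤ (1 / (2 * D)) * Real.exp (-(1 / 4) * s ^ 2) := by positivity
      linarith
    · have h1 : 2 * √(Real.log (2 * D)) ≤ |s| := by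
        refine hkD.trans ?_
        rw [div_le_iff₀ hk]
        linarith
      have h2 : 4 * Real.log (2 * D) ≤ s ^ 2 := by
        have := pow_le_pow_left₀ (by positivity) h1 2
        rw [mul_pow, Real.sq_sqrt hlog, sq_abs] at this
        linarith
      have h3 : Real.exp (-s ^ 2 / 2) ≤ (1 / (2 * D)) * Real.exp (-(1 / 4) * s ^ 2) := by
        have h6 : 1 / (2 * D) = Real.exp (-Real.log (2 * D)) := by
          rw [Real.exp_neg, Real.exp_log (by positivity), one_div]
        rw [h6, ← Real.exp_add]
        refine Real.exp_le_exp.2 ?_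
        linarith
      have h4 : Real.exp (-s ^ 2 / 2) * f s ≤ Real.exp (-s ^ 2 / 2) :=
        mul_le_of_le_one_right (Real.exp_pos _).le (hf1 s)
      have h5 : 0 ≤ (1 + (α * s) ^ 2)⁻¹ := by positivity
      linarith
  refine (integral_mono_of_nonneg (Filter.Eventually.of_forall fun s => ?_)
    ((hi1.add hi2).const_mul _) (Filter.Eventually.of_forall hpt)).trans ?_
  · exact mul_nonneg (gaussianPDFReal_nonneg _ _ _) (hf0 s)
  · simp only [Pi.add_apply]
    rw [integral_const_mul, integral_add hi1 hi2, integral_const_mul, integral_gaussian,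
      Measure.integral_comp_mul_left (fun s : ℝ => (1 + s ^ 2)⁻¹) α, integral_univ_inv_one_add_sq,
      abs_of_pos (by positivity), smul_eq_mul]
    have h1 : √(Real.pi / (1 / 4)) ≤ 4 :=
      Real.sqrt_le_iff.2 ⟨by norm_num, by linarith [Real.pi_le_four]⟩
    have h2 : α⁻¹ * Real.pi ≤ α⁻¹ * 4 := by
      gcongr
      exact Real.pi_le_four
    have h3 : 1 / (2 * D) * √(Real.pi / (1 / 4)) ≤ 1 / (2 * D) * 4 := by gcongr
    have h4 : 1 / (2 * D) * 4 = 2 * (1 / D) := by field_simp; norm_num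
    rw [div_eq_mul_inv 2 α]
    linarith

lemma norm_restrictCoords_sq {n : ℕ} (v : EuclideanSpace ℝ (Fin n)) (I : Finset (Fin n)) :
    ‖restrictCoords v I‖ ^ 2 = ∑ i ∈ I, v i ^ 2 := by
  rw [EuclideanSpace.norm_sq_eq, ← Finset.sum_coe_sort I]
  simp [restrictCoords]

lemma integral_block_le {n : ℕ} {v : EuclideanSpace ℝ (Fin n)} {I : Finset (Fin n)}
    {L D q r z : ℝ} {ℓ : ℕ} (hL : 1 ≤ L) (hD : 1 ≤ D) (hq : 2 ≤ 4 * q * L ^ 2) (hℓ : 1 ≤ ℓ)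
    (hz1 : 1 / 2 ≤ z ^ 2) (hz2 : z ^ 2 ≤ L ^ 2) (hr : 0 < r)
    (hrI : r ≤ ‖restrictCoords v I‖) (hI1 : ‖restrictCoords v I‖ ≤ 1)
    (hv : ∀ i ∈ I, |v i| ≤ r / (8 * L))
    (hlcd : D ≤ lcd L (‖restrictCoords v I‖⁻¹ • restrictCoords v I)) :
    ∫ s, Real.exp (-4 * q * ℓ * ∑ i ∈ I,
        distInt (s * (v i / (L * √(Real.log (2 * D)) / D)) * z / (2 * Real.pi)) ^ 2)
          ∂(gaussianReal 0 1)
      ≤ 26 * L * (L * √(Real.log (2 * D)) / D) / (r * √ℓ) + 1 / D := by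
  set β := L * √(Real.log (2 * D)) / D with hβ
  set ρ := ‖restrictCoords v I‖ with hρ
  have hD0 : 0 < D := by linarith
  have hL0 : 0 < L := by linarith
  have hlog : 0 < Real.log (2 * D) := Real.log_pos (by linarith)
  have hβ0 : 0 < β := by positivity
  have hρ0 : 0 < ρ := hr.trans_le hrI
  have hℓ0 : (0 : ℝ) < ℓ := by exact_mod_cast hℓ
  have hsℓ : 0 < √(ℓ : ℝ) := Real.sqrt_pos.2 hℓ0
  have hz0 : 0 < |z| := by
    rw [abs_pos]; rintro rfl; norm_num at hz1
  have hzL : |z| ≤ L := by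
    rw [← abs_of_pos hL0]
    exact sq_le_sq.1 hz2
  have hπ := Real.pi_pos
  have hq0 : 0 < q := by
    by_contra h
    push Not at h
    nlinarith [sq_nonneg L]
  -- `k |s|` is the parameter `θ` at which the normalized block is tested; the sign of `s z` is
  -- irrelevant because `distInt` is even.
  set k := |z| * ρ / (2 * Real.pi * β) with hk
  have hk0 : 0 < k := by positivity
  set α := k * √ℓ / (√2 * L) with hα
  have hα0 : 0 < α := by positivity
  have hsum : ∑ i ∈ I, (v i / ρ) ^ 2 = 1 := by
    have h1 : ρ ^ 2 = ∑ i ∈ I, v i ^ 2 := norm_restrictCoords_sq v I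
    simp_rw [div_pow]
    rw [← Finset.sum_div, ← h1, div_self (by positivity)]
  have hdist : ∀ s : ℝ, ∑ i ∈ I, distInt (s * (v i / β) * z / (2 * Real.pi)) ^ 2
      = ∑ i ∈ I, distInt (k * |s| * (v i / ρ)) ^ 2 := by
    intro s
    refine Finset.sum_congr rfl fun i _ => ?_
    rw [← distInt_abs, ← distInt_abs (k * |s| * (v i / ρ))]
    congr 2
    rw [hk]
    simp only [abs_mul, abs_div, abs_abs, abs_of_pos hβ0, abs_of_pos hρ0, abs_of_pos hπ,
      abs_two]
    field_simp
  have hmain : ∫ s, Real.exp (-4 * q * ℓ * ∑ i ∈ I,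
      distInt (s * (v i / β) * z / (2 * Real.pi)) ^ 2) ∂(gaussianReal 0 1) ≤ 2 / α + 1 / D := by
    refine integral_gaussianReal_le_of_le_inv (fun s => (Real.exp_pos _).le) (fun s => ?_)
      hα0 hk0 hD ?_ fun s hs => ?_
    · rw [Real.exp_le_one_iff]
      have : 0 ≤ q * ℓ * ∑ i ∈ I, distInt (s * (v i / β) * z / (2 * Real.pi)) ^ 2 :=
        mul_nonneg (by positivity) (Finset.sum_nonneg fun i _ => sq_nonneg _)
      linarith
    · have h1 : D / k = 2 * √(Real.log (2 * D)) * (Real.pi * L / (|z| * ρ)) := by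
        rw [hk, hβ]
        field_simp
      rw [h1]
      refine le_mul_of_one_le_right (by positivity) ?_
      rw [one_le_div (by positivity)]
      have : |z| * ρ ≤ L * 1 := by gcongr
      nlinarith [Real.pi_gt_three]
    · rw [hdist]
      refine (exp_neg_sum_distInt_le I (fun i => v i / ρ) hL0 hq hℓ hsum ?_ ?_
        (θ := k * |s|) (by positivity) hs).trans_eq ?_
      · intro i hi
        rw [abs_div, abs_of_pos hρ0, div_le_iff₀ hρ0]
        refine (hv i hi).trans ?_
        rw [div_eq_mul_one_div, mul_comm]
        gcongr
      · intro t ht htD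
        refine (le_sum_distInt_of_le_lcd hL0 hlcd ht htD).trans_eq ?_
        rw [← Finset.sum_coe_sort I]
        refine Finset.sum_congr rfl fun i _ => ?_
        simp [restrictCoords, div_eq_inv_mul]
      · congr 2
        have h2 : α ^ 2 = k ^ 2 * ℓ / (2 * L ^ 2) := by
          rw [hα, div_pow, mul_pow, mul_pow, Real.sq_sqrt hℓ0.le, Real.sq_sqrt (by norm_num)]
        rw [mul_pow, mul_pow, sq_abs, h2]
        ring
  refine hmain.trans (add_le_add_left ?_ _)
  have h1 : 2 / α = (√2 / |z|) * (4 * Real.pi * L * β) / (ρ * √ℓ) := by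
    rw [hα, hk]
    field_simp
    ring
  have h2 : √2 / |z| ≤ 2 := by
    rw [div_le_iff₀ hz0]
    refine Real.sqrt_le_iff.2 ⟨by positivity, ?_⟩
    rw [mul_pow, sq_abs]
    linarith
  rw [h1]
  -- The constant `26` bounds `8 π`.
  have h3 : (√2 / |z|) * (4 * Real.pi * L * β) ≤ 26 * L * β := by
    calc _ ≤ 2 * (4 * Real.pi * L * β) := by gcongr
      _ = (8 * Real.pi) * (L * β) := by ring
      _ ≤ 26 * (L * β) := by
        gcongr
        linarith [Real.pi_lt_d2]
      _ = _ := by ring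
  gcongr

/-- The set of pairs of values whose difference is of moderate size. -/
def moderatePairs (L : ℝ) : Set (ℝ × ℝ) :=
  {z | 1 / 2 ≤ (z.1 - z.2) ^ 2 ∧ (z.1 - z.2) ^ 2 ≤ L ^ 2}

lemma measurableSet_moderatePairs (L : ℝ) : MeasurableSet (moderatePairs L) :=
  MeasurableSet.inter
    (measurableSet_le (f := fun _ : ℝ × ℝ => (1 / 2 : ℝ)) (g := fun z => (z.1 - z.2) ^ 2)
      (by fun_prop) (by fun_prop))
    (measurableSet_le (f := fun z : ℝ × ℝ => (z.1 - z.2) ^ 2) (g := fun _ => L ^ 2)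
      (by fun_prop) (by fun_prop))

lemma integral_prod_charFun_blocks_le {n : ℕ} {κ : Type*} {v : EuclideanSpace ℝ (Fin n)}
    (ν : Measure ℝ) [IsProbabilityMeasure ν] {L D r : ℝ} (hL : 1 ≤ L) (hD : 1 ≤ D)
    (hν : 1 ≤ L ^ 2 * (ν.prod ν).real (moderatePairs L)) (hr : 0 < r)
    (J : Finset κ) (hJ : J.Nonempty) (G : κ → Finset (Fin n))
    (hG : Set.PairwiseDisjoint (↑J) G)
    (hrG : ∀ j ∈ J, r ≤ ‖restrictCoords v (G j)‖) (hG1 : ∀ j ∈ J, ‖restrictCoords v (G j)‖ ≤ 1)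
    (hv : ∀ j ∈ J, ∀ i ∈ G j, |v i| ≤ r / (8 * L))
    (hlcd : ∀ j ∈ J, D ≤ lcd L (‖restrictCoords v (G j)‖⁻¹ • restrictCoords v (G j))) :
    ∫ s, ∏ i ∈ J.biUnion G, ‖charFun ν (s * (v i / (L * √(Real.log (2 * D)) / D)))‖
        ∂(gaussianReal 0 1)
      ≤ 26 * L * (L * √(Real.log (2 * D)) / D) / (r * √J.card) + 1 / D := by
  have hq : 0 < (ν.prod ν).real (moderatePairs L) := by
    by_contra h
    push Not at h
    nlinarith [sq_nonneg L]
  refine integral_prod_charFun_le ν _ (measurableSet_moderatePairs L) hq _ J hJ G hG _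
    fun j hj z hz => ?_
  exact integral_block_le hL hD (by linarith) hJ.card_pos hz.1 hz.2 hr (hrG j hj) (hG1 j hj)
    (hv j hj) (hlcd j hj)

/-! ### Moments and symmetrization of the entries -/

lemma exists_lt_of_subGaussianNorm_lt {Ω : Type*} [MeasurableSpace Ω] {ξ : Ω → ℝ}
    {P : Measure Ω} {b : ℝ} (h : subGaussianNorm ξ P < ENNReal.ofReal b) :
    ∃ t : ℝ, 0 < t ∧ t < b ∧
      ∫⁻ ω, ENNReal.ofReal (Real.exp (ξ ω ^ 2 / t ^ 2)) ∂P ≤ 2 := by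
  simp only [subGaussianNorm, iInf_lt_iff] at h
  obtain ⟨t, ht, hlt⟩ := h
  exact ⟨t, ht.1, (ENNReal.ofReal_lt_ofReal_iff_of_nonneg ht.1.le).1 hlt, ht.2⟩

lemma integrable_pow_four_of_exp_sq {ν : Measure ℝ} {t : ℝ} (ht : 0 < t)
    (h : ∫⁻ x, ENNReal.ofReal (Real.exp (x ^ 2 / t ^ 2)) ∂ν ≤ 2) :
    Integrable (fun x => x ^ 4) ν ∧ ∫ x, x ^ 4 ∂ν ≤ 4 * t ^ 4 := by
  have hexp : Integrable (fun x => Real.exp (x ^ 2 / t ^ 2)) ν := by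
    refine ⟨by fun_prop, ?_⟩
    rw [hasFiniteIntegral_iff_ofReal (Filter.Eventually.of_forall fun x => (Real.exp_pos _).le)]
    exact h.trans_lt (by simp)
  have hle : ∫ x, Real.exp (x ^ 2 / t ^ 2) ∂ν ≤ 2 := by
    rw [integral_eq_lintegral_of_nonneg_ae
      (Filter.Eventually.of_forall fun x => (Real.exp_pos _).le) (by fun_prop)]
    exact ENNReal.toReal_le_of_le_ofReal (by norm_num) (h.trans_eq (by simp))
  have hpt : ∀ x : ℝ, x ^ 4 ≤ 2 * t ^ 4 * Real.exp (x ^ 2 / t ^ 2) := by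
    intro x
    have h1 := Real.quadratic_le_exp_of_nonneg (show 0 ≤ x ^ 2 / t ^ 2 by positivity)
    have h2 : (x ^ 2 / t ^ 2) ^ 2 / 2 ≤ Real.exp (x ^ 2 / t ^ 2) := by
      have : 0 ≤ x ^ 2 / t ^ 2 := by positivity
      linarith
    calc x ^ 4 = 2 * t ^ 4 * ((x ^ 2 / t ^ 2) ^ 2 / 2) := by field_simp
      _ ≤ _ := by gcongr
  have hi : Integrable (fun x : ℝ => x ^ 4) ν := by
    refine (hexp.const_mul (2 * t ^ 4)).mono' (by fun_prop)
      (Filter.Eventually.of_forall fun x => ?_)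
    rw [Real.norm_of_nonneg (by positivity)]
    exact hpt x
  refine ⟨hi, ?_⟩
  calc ∫ x, x ^ 4 ∂ν ≤ ∫ x, 2 * t ^ 4 * Real.exp (x ^ 2 / t ^ 2) ∂ν :=
        integral_mono hi (hexp.const_mul _) hpt
    _ = 2 * t ^ 4 * ∫ x, Real.exp (x ^ 2 / t ^ 2) ∂ν := integral_const_mul _ _
    _ ≤ 2 * t ^ 4 * 2 := by gcongr
    _ = _ := by ring

/-- A Paley-Zygmund type bound for the symmetrization of a centred variable of variance one. -/
lemma one_le_mul_measureReal_moderatePairs {ν : Measure ℝ} [IsProbabilityMeasure ν] {t L : ℝ}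
    (hL : 12 * t ^ 2 ≤ L) (hmean : ∫ x, x ∂ν = 0) (hvar : ∫ x, x ^ 2 ∂ν = 1) (ht : 0 < t)
    (h : ∫⁻ x, ENNReal.ofReal (Real.exp (x ^ 2 / t ^ 2)) ∂ν ≤ 2) :
    1 ≤ L ^ 2 * (ν.prod ν).real (moderatePairs L) := by
  obtain ⟨hi4, h4⟩ := integrable_pow_four_of_exp_sq ht h
  have hL0 : 0 < L := lt_of_lt_of_le (by positivity) hL
  have hi2 : Integrable (fun x : ℝ => x ^ 2) ν := by
    refine ((integrable_const (1 : ℝ)).add hi4).mono' (by fun_prop)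
      (Filter.Eventually.of_forall fun x => ?_)
    rw [Real.norm_of_nonneg (by positivity)]
    simp only [Pi.add_apply]
    nlinarith [sq_nonneg (x ^ 2 - 1), sq_nonneg (x ^ 2)]
  have hi1 : Integrable (fun x : ℝ => x) ν := by
    refine ((integrable_const (1 : ℝ)).add hi2).mono' (by fun_prop)
      (Filter.Eventually.of_forall fun x => ?_)
    simp only [Pi.add_apply, Real.norm_eq_abs]
    nlinarith [sq_nonneg (|x| - 1), sq_abs x]
  have hf2 := hi2.comp_fst (ν := ν)
  have hs2 := hi2.comp_snd (μ := ν)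
  have hx := hi1.mul_prod hi1
  have hf4 := hi4.comp_fst (ν := ν)
  have hs4 := hi4.comp_snd (μ := ν)
  have hfs2 : Integrable (fun z : ℝ × ℝ => z.1 ^ 2 + z.2 ^ 2) (ν.prod ν) := hf2.add hs2
  have hz2e : ∀ z : ℝ × ℝ, (z.1 - z.2) ^ 2 = z.1 ^ 2 + z.2 ^ 2 - 2 * (z.1 * z.2) :=
    fun z => by ring
  have hz2i : Integrable (fun z : ℝ × ℝ => (z.1 - z.2) ^ 2) (ν.prod ν) := by
    simp_rw [hz2e]
    exact hfs2.sub (hx.const_mul 2)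
  have hz2 : ∫ z : ℝ × ℝ, (z.1 - z.2) ^ 2 ∂(ν.prod ν) = 2 := by
    simp_rw [hz2e]
    rw [integral_sub hfs2 (hx.const_mul 2), integral_add hf2 hs2, integral_const_mul,
      integral_prod_mul (fun x : ℝ => x) (fun x : ℝ => x), integral_fun_fst (fun x : ℝ => x ^ 2),
      integral_fun_snd (fun x : ℝ => x ^ 2), hvar, hmean]
    norm_num
  have hb4 : ∀ z : ℝ × ℝ, (z.1 - z.2) ^ 4 ≤ 8 * (z.1 ^ 4 + z.2 ^ 4) := by
    intro z
    have h1 : (z.1 - z.2) ^ 2 ≤ 2 * (z.1 ^ 2 + z.2 ^ 2) := by nlinarith [sq_nonneg (z.1 + z.2)]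
    have h2 := pow_le_pow_left₀ (sq_nonneg _) h1 2
    nlinarith [sq_nonneg (z.1 ^ 2 - z.2 ^ 2)]
  have hz4i : Integrable (fun z : ℝ × ℝ => (z.1 - z.2) ^ 4) (ν.prod ν) := by
    refine ((hf4.add hs4).const_mul 8).mono' (by fun_prop)
      (Filter.Eventually.of_forall fun z => ?_)
    rw [Real.norm_of_nonneg (by positivity)]
    exact hb4 z
  have hz4 : ∫ z : ℝ × ℝ, (z.1 - z.2) ^ 4 ∂(ν.prod ν) ≤ 64 * t ^ 4 := by
    refine (integral_mono hz4i ((hf4.add hs4).const_mul 8) hb4).trans ?_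
    simp only [Pi.add_apply]
    rw [integral_const_mul, integral_add hf4 hs4, integral_fun_fst (fun x : ℝ => x ^ 4),
      integral_fun_snd (fun x : ℝ => x ^ 4)]
    simp
    linarith
  have hmR := measurableSet_moderatePairs L
  have hiR : Integrable ((moderatePairs L).indicator fun _ => L ^ 2) (ν.prod ν) :=
    (integrable_const _).indicator hmR
  have hcR : Integrable (fun z : ℝ × ℝ =>
      1 / 2 + (moderatePairs L).indicator (fun _ => L ^ 2) z) (ν.prod ν) :=
    (integrable_const _).add hiR
  -- A difference that is not moderate has square either below `1/2` or above `L²`; the latter case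
  -- is covered by the fourth moment. Integrating gives `2 ≤ 1/2 + L² q + 1/2`, where `q` is the
  -- mass of `moderatePairs L`.
  have hpt : ∀ z : ℝ × ℝ, (z.1 - z.2) ^ 2
      ≤ 1 / 2 + (moderatePairs L).indicator (fun _ => L ^ 2) z
        + (L ^ 2)⁻¹ * (z.1 - z.2) ^ 4 := by
    intro z
    have h0 : 0 ≤ (L ^ 2)⁻¹ * (z.1 - z.2) ^ 4 := by positivity
    have h00 : 0 ≤ (moderatePairs L).indicator (fun _ => L ^ 2) z :=
      Set.indicator_nonneg (fun _ _ => by positivity) _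
    by_cases hz : z ∈ moderatePairs L
    · rw [Set.indicator_of_mem hz]
      linarith [hz.2]
    · rcases lt_or_ge ((z.1 - z.2) ^ 2) (1 / 2) with h1 | h1
      · linarith
      · have h2 : L ^ 2 < (z.1 - z.2) ^ 2 := by
          by_contra! hc
          exact hz ⟨h1, hc⟩
        have h3 : (z.1 - z.2) ^ 2 ≤ (L ^ 2)⁻¹ * (z.1 - z.2) ^ 4 := by
          rw [inv_mul_eq_div, le_div_iff₀ (by positivity)]
          nlinarith
        linarith
  have hle := integral_mono hz2i (hcR.add (hz4i.const_mul _)) hpt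
  simp only [Pi.add_apply] at hle
  rw [hz2, integral_add hcR (hz4i.const_mul _), integral_add (integrable_const _) hiR,
    integral_const_mul, integral_indicator_const _ hmR] at hle
  simp only [integral_const, probReal_univ, smul_eq_mul, one_mul] at hle
  have h5 : (L ^ 2)⁻¹ * ∫ z : ℝ × ℝ, (z.1 - z.2) ^ 4 ∂(ν.prod ν) ≤ 1 / 2 := by
    rw [inv_mul_le_iff₀ (by positivity)]
    have := pow_le_pow_left₀ (by positivity) hL 2
    have h6 : 0 ≤ t ^ 4 := by positivity
    nlinarith
  linarith

/-! ### Row-by-row integration over the upper triangle -/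

/-- `G` does not see the coordinates in `S`, so `F` can be averaged over `S` with all others frozen.
One application removes one row. -/
lemma lintegral_mul_le_of_lmarginal_le {δ : Type*} [Fintype δ] [DecidableEq δ] {X : δ → Type*}
    [∀ i, MeasurableSpace (X i)] (μ : ∀ i, Measure (X i)) [∀ i, IsProbabilityMeasure (μ i)]
    (S : Finset δ) {F G : (∀ i, X i) → ℝ≥0∞} (hF : Measurable F) (hG : Measurable G)
    (hGS : ∀ x y, G (Function.updateFinset x S y) = G x) {p : ℝ≥0∞}
    (hp : ∀ x, lmarginal μ S F x ≤ p) :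
    ∫⁻ x, F x * G x ∂(Measure.pi μ) ≤ p * ∫⁻ x, G x ∂(Measure.pi μ) := by
  rw [← lintegral_const_mul _ hG]
  refine lintegral_le_of_lmarginal_le S (hF.mul hG) (hG.const_mul p) fun x => ?_
  have hFm : Measurable fun y => F (Function.updateFinset x S y) :=
    hF.comp measurable_updateFinset
  simp only [lmarginal, hGS]
  rw [lintegral_mul_const _ hFm, lintegral_const, measure_univ, mul_one]
  exact mul_le_mul_left (hp x) _

/-- The index of the entry `(i, j)` of a symmetric matrix in the upper triangle. -/
def entryIdx {n : ℕ} (i j : Fin n) : {p : Fin n × Fin n // p.1 ≤ p.2} :=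
  ⟨(min i j, max i j), min_le_max⟩

lemma entryIdx_eq_iff {n : ℕ} {i j k l : Fin n} :
    entryIdx i j = entryIdx k l ↔ (i = k ∧ j = l) ∨ (i = l ∧ j = k) := by
  simp only [entryIdx, Subtype.mk.injEq, Prod.mk.injEq]
  constructor
  · rintro ⟨h1, h2⟩
    rcases le_total i j with h | h <;> rcases le_total k l with h' | h' <;>
      simp only [min_eq_left, min_eq_right, max_eq_left, max_eq_right, h, h'] at h1 h2 <;> tauto
  · rintro (⟨rfl, rfl⟩ | ⟨rfl, rfl⟩)
    · exact ⟨rfl, rfl⟩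
    · exact ⟨min_comm _ _, max_comm _ _⟩

lemma entryIdx_injective {n : ℕ} (k : Fin n) : Function.Injective (entryIdx k) := by
  intro i j h
  rcases entryIdx_eq_iff.1 h with ⟨_, h⟩ | ⟨h, h'⟩
  · exact h
  · exact h'.trans h

/-- The `k`-th coordinate of `A v - u`, in terms of the upper triangle of `A`. -/
def rowValue {n : ℕ} (v u : EuclideanSpace ℝ (Fin n)) (k : Fin n)
    (a : {p : Fin n × Fin n // p.1 ≤ p.2} → ℝ) : ℝ :=
  ∑ i, a (entryIdx k i) * v i - u k

lemma measurable_rowValue {n : ℕ} (v u : EuclideanSpace ℝ (Fin n)) (k : Fin n) :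
    Measurable (rowValue v u k) := by
  unfold rowValue
  fun_prop

/-- The frozen entries of the row and `u k` merge into a deterministic shift, on which the bound of
`integral_exp_neg_sq_le` does not depend. -/
lemma lmarginal_rowValue_le {n : ℕ} (ν : Measure ℝ) [IsProbabilityMeasure ν]
    (v u : EuclideanSpace ℝ (Fin n)) (k : Fin n) (I : Finset (Fin n)) {β p : ℝ}
    (hp : ∫ s, ∏ i ∈ I, ‖charFun ν (s * (v i / β))‖ ∂(gaussianReal 0 1) ≤ p)
    (x : {p : Fin n × Fin n // p.1 ≤ p.2} → ℝ) :
    lmarginal (fun _ => ν) (I.image (entryIdx k))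
      (fun a => ENNReal.ofReal (Real.exp (-(rowValue v u k a / β) ^ 2 / 2))) x
        ≤ ENNReal.ofReal p := by
  set S := I.image (entryIdx k) with hS
  set w : {p : Fin n × Fin n // p.1 ≤ p.2} → ℝ :=
    fun e => ∑ i, if entryIdx k i = e then v i else 0 with hw
  have hwk : ∀ i, w (entryIdx k i) = v i := by
    intro i
    simp [hw, (entryIdx_injective k).eq_iff]
  have hrow : ∀ a, rowValue v u k a = ∑ e, w e * a e - u k := by
    intro a
    rw [rowValue]
    congr 1
    simp only [hw, Finset.sum_mul, ite_mul, zero_mul]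
    rw [Finset.sum_comm]
    refine Finset.sum_congr rfl fun i _ => ?_
    simp [mul_comm]
  have hupd : ∀ y, rowValue v u k (Function.updateFinset x S y)
      = ∑ e : S, w e * y e + (∑ e ∈ Sᶜ, w e * x e - u k) := by
    intro y
    rw [hrow, ← Finset.sum_add_sum_compl S, add_sub_assoc, ← Finset.sum_coe_sort S]
    congr 1
    · refine Finset.sum_congr rfl fun e _ => ?_
      simp [Function.updateFinset]
    · congr 1
      refine Finset.sum_congr rfl fun e he => ?_
      simp [Function.updateFinset, Finset.mem_compl.1 he]
  simp only [lmarginal, hupd]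
  rw [← ofReal_integral_eq_lintegral_ofReal]
  · refine ENNReal.ofReal_le_ofReal ((integral_exp_neg_sq_le ν _ _ β).trans (hp.trans' ?_))
    refine le_of_eq ?_
    congr 1; ext s
    rw [Finset.prod_coe_sort S fun e => ‖charFun ν (s * w e / β)‖, hS,
      Finset.prod_image (entryIdx_injective k).injOn]
    refine Finset.prod_congr rfl fun i _ => ?_
    rw [hwk, mul_div_assoc]
  · refine Integrable.of_bound (C := 1) (Measurable.aestronglyMeasurable (by fun_prop))
      (Filter.Eventually.of_forall fun a => ?_)
    rw [Real.norm_of_nonneg (Real.exp_pos _).le, Real.exp_le_one_iff]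
    have : 0 ≤ ((∑ e : S, w e * a e + (∑ e ∈ Sᶜ, w e * x e - u k)) / β) ^ 2 := sq_nonneg _
    linarith
  · exact Filter.Eventually.of_forall fun a => (Real.exp_pos _).le

/-- Rows are integrated one after the other, each over the entries in columns of lower level. -/
lemma lintegral_prod_rowValue_le {n : ℕ} (ν : Measure ℝ) [IsProbabilityMeasure ν]
    (v u : EuclideanSpace ℝ (Fin n)) {β : ℝ} (lev : Fin n → ℕ) (p : Fin n → ℝ)
    (R : Finset (Fin n))
    (hp : ∀ k ∈ R, ∫ s, ∏ i with lev i < lev k, ‖charFun ν (s * (v i / β))‖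
      ∂(gaussianReal 0 1) ≤ p k) :
    ∫⁻ a, ∏ k ∈ R, ENNReal.ofReal (Real.exp (-(rowValue v u k a / β) ^ 2 / 2))
      ∂(Measure.pi fun _ : {p : Fin n × Fin n // p.1 ≤ p.2} => ν)
        ≤ ∏ k ∈ R, ENNReal.ofReal (p k) := by
  have hmeas : ∀ k, Measurable fun a =>
      ENNReal.ofReal (Real.exp (-(rowValue v u k a / β) ^ 2 / 2)) := by
    intro k
    have := measurable_rowValue v u k
    fun_prop
  induction R using Finset.induction_on_min_value lev with
  | empty => simp
  | insert k s hks hmin ih =>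
    simp only [Finset.prod_insert hks]
    refine (lintegral_mul_le_of_lmarginal_le (fun _ => ν)
      ((Finset.univ.filter fun i => lev i < lev k).image (entryIdx k)) (hmeas k)
      (Finset.measurable_prod _ fun k _ => hmeas k) (fun x y => ?_)
      (lmarginal_rowValue_le ν v u k _ (hp k (Finset.mem_insert_self _ _)))).trans ?_
    · refine Finset.prod_congr rfl fun l hl => ?_
      have hl' : rowValue v u l (Function.updateFinset x
          ((Finset.univ.filter fun i => lev i < lev k).image (entryIdx k)) y)
          = rowValue v u l x := by
        unfold rowValue
        congr 1
        refine Finset.sum_congr rfl fun i _ => ?_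
        congr 1
        rw [Function.updateFinset, dif_neg]
        intro hmem
        obtain ⟨j, hj, hjl⟩ := Finset.mem_image.1 hmem
        have hj' := (Finset.mem_filter.1 hj).2
        -- An integrated entry `(k, j)` could occur in row `l` only if `l = k`, excluded since `k ∉
        -- s`, or if `l = j`, excluded since `lev j < lev k ≤ lev l`.
        rcases entryIdx_eq_iff.1 hjl with ⟨h, _⟩ | ⟨_, h⟩
        · exact hks (h ▸ hl)
        · exact absurd (hmin l hl) (by rw [← h]; exact not_le.2 hj')
      rw [hl']
    · exact mul_le_mul_right (ih fun l hl => hp l (Finset.mem_insert_of_mem hl)) _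

lemma map_entries_eq_pi {Ω Ω' : Type*} [MeasurableSpace Ω] [MeasurableSpace Ω'] {n : ℕ}
    {A : Ω → Matrix (Fin n) (Fin n) ℝ} {μ : Measure Ω} [IsProbabilityMeasure μ]
    {ξ : Ω' → ℝ} {P : Measure Ω'} (hA : IsSymmetricRandomMatrix A μ ξ P) :
    μ.map (fun ω (p : {p : Fin n × Fin n // p.1 ≤ p.2}) => A ω p.1.1 p.1.2)
      = Measure.pi fun _ => P.map ξ := by
  rw [(iIndepFun_iff_map_fun_eq_pi_map fun p =>
    (hA.identDistrib _ _ p.2).aemeasurable_fst).1 hA.indep]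
  congr 1; ext1 p
  exact (hA.identDistrib _ _ p.2).map_eq

lemma measureReal_norm_le {Ω Ω' : Type*} [MeasurableSpace Ω] [MeasurableSpace Ω'] {n : ℕ}
    {A : Ω → Matrix (Fin n) (Fin n) ℝ} {μ : Measure Ω} [IsProbabilityMeasure μ]
    {ξ : Ω' → ℝ} {P : Measure Ω'} [IsProbabilityMeasure P] (hξ : AEMeasurable ξ P)
    (hA : IsSymmetricRandomMatrix A μ ξ P)
    (v u : EuclideanSpace ℝ (Fin n)) {β t : ℝ} (lev : Fin n → ℕ) (p : Fin n → ℝ)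
    (R : Finset (Fin n)) (hβ : 0 < β) (hp0 : ∀ k ∈ R, 0 ≤ p k)
    (hp : ∀ k ∈ R, ∫ s, ∏ i with lev i < lev k, ‖charFun (P.map ξ) (s * (v i / β))‖
      ∂(gaussianReal 0 1) ≤ p k) :
    μ.real {ω | ‖Matrix.toEuclideanLin (A ω) v - u‖ ≤ t}
      ≤ Real.exp ((t / β) ^ 2 / 2) * ∏ k ∈ R, p k := by
  have := Measure.isProbabilityMeasure_map hξ
  set E : Ω → {p : Fin n × Fin n // p.1 ≤ p.2} → ℝ := fun ω p => A ω p.1.1 p.1.2 with hE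
  have hEm : AEMeasurable E μ := aemeasurable_pi_lambda _ fun p =>
    (hA.identDistrib _ _ p.2).aemeasurable_fst
  have hrow : ∀ ω k, (Matrix.toEuclideanLin (A ω) v - u) k = rowValue v u k (E ω) := by
    intro ω k
    have hs : ∀ i, A ω k i = E ω (entryIdx k i) := by
      intro i
      simp only [hE, entryIdx]
      rcases le_total k i with h | h
      · simp [h]
      · simpa [h] using (hA.isSymm ω).apply i k
    simp [rowValue, Matrix.toLpLin_apply, Matrix.mulVec, dotProduct, hs]
  set c := ENNReal.ofReal (Real.exp (-((t / β) ^ 2 / 2))) with hc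
  set g : ({p : Fin n × Fin n // p.1 ≤ p.2} → ℝ) → ℝ≥0∞ := fun a =>
    ∏ k ∈ R, ENNReal.ofReal (Real.exp (-(rowValue v u k a / β) ^ 2 / 2)) with hg
  have hgm : Measurable g := Finset.measurable_prod _ fun k _ => by
    have := measurable_rowValue v u k
    fun_prop
  have hsub : {ω | ‖Matrix.toEuclideanLin (A ω) v - u‖ ≤ t} ⊆ E ⁻¹' {a | c ≤ g a} := by
    intro ω hω
    simp only [Set.mem_ofPred_eq, Set.mem_preimage] at hω ⊢
    rw [hc, hg]
    dsimp only
    rw [← ENNReal.ofReal_prod_of_nonneg fun k _ => (Real.exp_pos _).le, ← Real.exp_sum]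
    refine ENNReal.ofReal_le_ofReal (Real.exp_le_exp.2 ?_)
    have h1 : ∑ k ∈ R, rowValue v u k (E ω) ^ 2 ≤ t ^ 2 := by
      calc _ ≤ ∑ k, rowValue v u k (E ω) ^ 2 :=
            Finset.sum_le_univ_sum_of_nonneg fun k => sq_nonneg _
        _ = ‖Matrix.toEuclideanLin (A ω) v - u‖ ^ 2 := by
            rw [EuclideanSpace.norm_sq_eq]
            refine Finset.sum_congr rfl fun k _ => ?_
            rw [hrow, Real.norm_eq_abs, sq_abs]
        _ ≤ t ^ 2 := pow_le_pow_left₀ (norm_nonneg _) hω 2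
    have h2 : ∑ k ∈ R, -(rowValue v u k (E ω) / β) ^ 2 / 2
        = -((∑ k ∈ R, rowValue v u k (E ω) ^ 2) / β ^ 2 / 2) := by
      rw [Finset.sum_div, Finset.sum_div, ← Finset.sum_neg_distrib]
      exact Finset.sum_congr rfl fun k _ => by rw [div_pow]; ring
    rw [h2, div_pow]
    gcongr
  have hmain : c * μ {ω | ‖Matrix.toEuclideanLin (A ω) v - u‖ ≤ t}
      ≤ ENNReal.ofReal (∏ k ∈ R, p k) := by
    calc c * μ {ω | ‖Matrix.toEuclideanLin (A ω) v - u‖ ≤ t}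
        ≤ c * μ (E ⁻¹' {a | c ≤ g a}) := by gcongr
      _ = c * (Measure.pi fun _ => P.map ξ) {a | c ≤ g a} := by
          rw [← map_entries_eq_pi hA, Measure.map_apply_of_aemeasurable hEm
            (measurableSet_le measurable_const hgm)]
      _ ≤ ∫⁻ a, g a ∂(Measure.pi fun _ => P.map ξ) := mul_meas_ge_le_lintegral hgm c
      _ ≤ _ := by
          rw [ENNReal.ofReal_prod_of_nonneg hp0]
          exact lintegral_prod_rowValue_le _ v u lev p R hp
  have h3 := ENNReal.toReal_mono ENNReal.ofReal_ne_top hmain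
  rw [ENNReal.toReal_mul, hc, ENNReal.toReal_ofReal (Real.exp_pos _).le,
    ENNReal.toReal_ofReal (Finset.prod_nonneg hp0), Real.exp_neg,
    inv_mul_le_iff₀ (Real.exp_pos _)] at h3
  exact h3

/-! ### Good blocks, levels and the product over rows -/

lemma upperMedian_le_sort {T : ℕ} (f : Fin T → ℝ) {j : ℕ} (h : T / 2 + j < T) :
    upperMedian f ≤ f (Tuple.sort f ⟨T / 2 + j, h⟩) := by
  rw [upperMedian, dif_pos (by omega)]
  exact Tuple.monotone_sort f (Fin.mk_le_mk.2 (Nat.le_add_right _ _))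

/-- At least half of the blocks have a denominator not below the median. -/
lemma exists_blocks_of_mem_levelSet {n : ℕ} {c₀ c₁ cs lam : ℝ}
    (S : SpreadChoice n c₀ c₁ cs lam) {L D : ℝ} {v : EuclideanSpace ℝ (Fin n)}
    (hv : v ∈ levelSet S L D) :
    ∃ (m : ℕ) (G : ℕ → Finset (Fin n)), blockCount n cs lam ≤ 2 * m ∧ m ≤ blockCount n cs lam ∧
      (∀ i < m, ∀ j < m, i ≠ j → Disjoint (G i) (G j)) ∧
      ∀ j < m, G j ⊆ S.spread v ∧ (G j).card = ⌈lam * n⌉₊ ∧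
        D ≤ lcd L (‖restrictCoords v (G j)‖⁻¹ • restrictCoords v (G j)) := by
  obtain ⟨hvI, hmed, -⟩ := hv
  set T := blockCount n cs lam with hT
  set f : Fin T → ℝ := fun j => lcd L (‖restrictCoords v (S.block (S.spread v) j)‖⁻¹ •
      restrictCoords v (S.block (S.spread v) j)) with hf
  have hcard := S.card_spread v hvI
  -- The sorted positions `T / 2, …, T - 1` are those at or above the upper median.
  refine ⟨T - T / 2, fun j => if h : T / 2 + j < T then
    S.block (S.spread v) (Tuple.sort f ⟨T / 2 + j, h⟩) else ∅, by omega, by omega, ?_, ?_⟩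
  · intro i hi j hj hij
    have h1 : T / 2 + i < T := by omega
    have h2 : T / 2 + j < T := by omega
    simp only [h1, h2, dif_pos]
    refine S.block_disjoint _ hcard fun h => hij ?_
    have := (Tuple.sort f).injective h
    simp only [Fin.mk.injEq] at this
    omega
  · intro j hj
    have h1 : T / 2 + j < T := by omega
    beta_reduce
    rw [dif_pos h1]
    refine ⟨S.block_subset _ hcard _, S.card_block _ hcard _, ?_⟩
    exact hmed.trans (upperMedian_le_sort f h1)

lemma exists_level {α : Type*} (m : ℕ) (G : ℕ → Finset α)
    (hG : ∀ i < m, ∀ j < m, i ≠ j → Disjoint (G i) (G j)) :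
    ∃ lev : α → ℕ, (∀ k, lev k ≤ m) ∧ ∀ j < m, ∀ k, lev k = j ↔ k ∈ G j := by
  classical
  refine ⟨fun k => if h : ∃ j, j < m ∧ k ∈ G j then h.choose else m, fun k => ?_,
    fun j hj k => ?_⟩
  · dsimp only
    split_ifs with h
    · exact h.choose_spec.1.le
    · exact le_rfl
  · dsimp only
    split_ifs with h
    · constructor
      · rintro rfl
        exact h.choose_spec.2
      · intro hk
        by_contra hne
        exact Finset.disjoint_left.1 (hG _ h.choose_spec.1 _ hj hne) h.choose_spec.2 hk
    · exact ⟨fun h' => absurd hj (by omega), fun hk => absurd ⟨j, hj, hk⟩ h⟩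

/-- At most `N` rows on each level below `m` give `(m ^ m / m!) ^ N`. Level `m` may hold many more
rows, but each contributes the factor `1`. -/
lemma prod_div_level_le {α : Type*} (R : Finset α) (lev : α → ℕ) (m N : ℕ)
    (hle : ∀ k ∈ R, lev k ≤ m) (hpos : ∀ k ∈ R, 1 ≤ lev k)
    (hcard : ∀ j < m, 1 ≤ j → {k ∈ R | lev k = j}.card ≤ N) :
    ∏ k ∈ R, (m / lev k : ℝ) ≤ Real.exp (m * N) := by
  rw [← Finset.prod_fiberwise_of_maps_to' (t := Finset.Icc 1 m) (g := lev)
    (fun k hk => Finset.mem_Icc.2 ⟨hpos k hk, hle k hk⟩) fun j : ℕ => (m / j : ℝ)]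
  calc ∏ j ∈ Finset.Icc 1 m, ∏ k ∈ R with lev k = j, (m / j : ℝ)
      ≤ ∏ j ∈ Finset.Icc 1 m, (m / j : ℝ) ^ N := by
        refine Finset.prod_le_prod (fun j _ => Finset.prod_nonneg fun _ _ => by positivity)
          fun j hj => ?_
        obtain ⟨h1, h2⟩ := Finset.mem_Icc.1 hj
        have hj0 : (0 : ℝ) < j := by exact_mod_cast h1
        have hjm : (1 : ℝ) ≤ m / j := by
          rw [one_le_div hj0]
          exact_mod_cast h2
        rw [Finset.prod_const]
        rcases h2.lt_or_eq with h | rfl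
        · exact pow_le_pow_right₀ hjm (hcard j h h1)
        · rw [div_self hj0.ne', one_pow, one_pow]
    _ = ((m : ℝ) ^ m / m.factorial) ^ N := by
        rw [Finset.prod_pow, Finset.prod_div_distrib, Finset.prod_const, Nat.card_Icc,
          add_tsub_cancel_right, ← Nat.cast_prod, ← Finset.prod_range_add_one_eq_factorial,
          Finset.range_eq_Ico, Finset.prod_Ico_add' (fun i : ℕ => i) 0 m 1, zero_add,
          Finset.Ico_add_one_right_eq_Icc]
    _ ≤ Real.exp m ^ N := by
        gcongr
        exact Real.pow_div_factorial_le_exp _ (by positivity) m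
    _ = Real.exp (m * N) := by rw [← Real.exp_nat_mul, mul_comm]

lemma prod_div_sqrt_level_le {α : Type*} (R : Finset α) (lev : α → ℕ) {m N n : ℕ} {a lam δ : ℝ}
    (ha : 0 ≤ a) (hδ : 0 < δ) (hlam : δ ≤ lam * m) (hmN : m * N ≤ n)
    (hle : ∀ k ∈ R, lev k ≤ m) (hpos : ∀ k ∈ R, 1 ≤ lev k)
    (hcard : ∀ j < m, 1 ≤ j → {k ∈ R | lev k = j}.card ≤ N) :
    ∏ k ∈ R, a / √(lam * lev k) ≤ (a / √δ) ^ R.card * Real.exp (n / 2) := by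
  have hlm : 0 < lam * m := hδ.trans_le hlam
  have hm : (0 : ℝ) < m := by
    rcases Nat.eq_zero_or_pos m with rfl | h
    · simp at hlm
    · exact_mod_cast h
  have hl0 : 0 < lam := pos_of_mul_pos_left hlm hm.le
  have hpt : ∀ k ∈ R, a / √(lam * lev k) ≤ a / √δ * √(m / lev k) := by
    intro k hk
    have hk0 : (0 : ℝ) < lev k := by exact_mod_cast hpos k hk
    have h1 : a / √(lam * lev k) = a / √(lam * m) * √(m / lev k) := by
      rw [Real.sqrt_mul hl0.le, Real.sqrt_mul hl0.le, Real.sqrt_div hm.le]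
      have := Real.sqrt_pos.2 hm
      field_simp
    rw [h1]
    gcongr
  calc ∏ k ∈ R, a / √(lam * lev k) ≤ ∏ k ∈ R, a / √δ * √(m / lev k) :=
        Finset.prod_le_prod (fun _ _ => by positivity) hpt
    _ = (a / √δ) ^ R.card * √(∏ k ∈ R, (m / lev k : ℝ)) := by
        rw [Finset.prod_mul_distrib, Finset.prod_const,
          Real.sqrt_prod _ fun _ _ => by positivity]
    _ ≤ (a / √δ) ^ R.card * Real.exp (n / 2) := by
        gcongr
        rw [Real.exp_half]
        refine Real.sqrt_le_sqrt ((prod_div_level_le R lev m N hle hpos hcard).trans ?_)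
        gcongr
        exact_mod_cast hmN

lemma norm_restrictCoords_le {n : ℕ} (v : EuclideanSpace ℝ (Fin n)) (I : Finset (Fin n)) :
    ‖restrictCoords v I‖ ≤ ‖v‖ := by
  refine le_of_sq_le_sq ?_ (norm_nonneg _)
  rw [norm_restrictCoords_sq, EuclideanSpace.norm_sq_eq]
  simp only [Real.norm_eq_abs, sq_abs]
  exact Finset.sum_le_univ_sum_of_nonneg fun i => sq_nonneg _

lemma le_norm_restrictCoords {n : ℕ} (hn : 0 < n) {c₁ lam : ℝ} (hc₁ : 0 < c₁) (hlam : 0 < lam)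
    {v : EuclideanSpace ℝ (Fin n)} {I : Finset (Fin n)} (hI : I.card = ⌈lam * n⌉₊)
    (hv : ∀ i ∈ I, c₁ / √(2 * n) ≤ |v i|) :
    c₁ * √(lam / 2) ≤ ‖restrictCoords v I‖ := by
  have hn' : (0 : ℝ) < n := by exact_mod_cast hn
  refine le_of_sq_le_sq ?_ (norm_nonneg _)
  rw [norm_restrictCoords_sq, mul_pow, Real.sq_sqrt (by positivity)]
  calc c₁ ^ 2 * (lam / 2) = lam * n * (c₁ / √(2 * n)) ^ 2 := by
        rw [div_pow, Real.sq_sqrt (by positivity)]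
        field_simp
    _ ≤ I.card * (c₁ / √(2 * n)) ^ 2 := by
        gcongr
        rw [hI]
        exact Nat.le_ceil _
    _ = ∑ i ∈ I, (c₁ / √(2 * n)) ^ 2 := by rw [Finset.sum_const, nsmul_eq_mul]
    _ ≤ ∑ i ∈ I, v i ^ 2 := by
        refine Finset.sum_le_sum fun i hi => ?_
        rw [← sq_abs (v i)]
        exact pow_le_pow_left₀ (by positivity) (hv i hi) 2

lemma abs_le_of_spread {n : ℕ} (hn : 0 < n) {c₀ c₁ lam L : ℝ} (hc₀ : 0 < c₀) (hc₁ : 0 < c₁)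
    (hL : 0 < L) (hlam : 128 * L ^ 2 / (c₁ ^ 2 * c₀) ≤ lam * n) {x : ℝ}
    (hx : |x| ≤ 1 / √(c₀ * n)) : |x| ≤ c₁ * √(lam / 2) / (8 * L) := by
  have hn' : (0 : ℝ) < n := by exact_mod_cast hn
  have hl0 : 0 < lam := pos_of_mul_pos_left (lt_of_lt_of_le (by positivity) hlam) hn'.le
  refine hx.trans (le_of_sq_le_sq ?_ (by positivity))
  rw [div_pow, div_pow, mul_pow, mul_pow, Real.sq_sqrt (by positivity),
    Real.sq_sqrt (by positivity), div_le_div_iff₀ (by positivity) (by positivity)]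
  rw [div_le_iff₀ (by positivity)] at hlam
  nlinarith

/-- The size and the number of blocks. -/
lemma block_numerics {n : ℕ} (hn : 0 < n) {cs lam : ℝ} (hcs : 0 < cs) (hcs1 : cs < 1 / 5)
    (hlam1 : 1 ≤ lam * n) (hlam : lam < cs / 8) {m : ℕ} (hm : blockCount n cs lam ≤ 2 * m)
    (hm' : m ≤ blockCount n cs lam) :
    cs / 8 ≤ lam * m ∧ m * ⌈lam * n⌉₊ ≤ n ∧ lam * m ≤ 1 ∧ n ≤ 2 * (n - ⌈lam * n⌉₊) := by
  have hn' : (0 : ℝ) < n := by exact_mod_cast hn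
  have hl0 : 0 < lam := pos_of_mul_pos_left (by linarith) hn'.le
  set N := ⌈lam * n⌉₊ with hN
  have hNle : (N : ℝ) ≤ 2 * (lam * n) := by
    have := Nat.ceil_lt_add_one (show 0 ≤ lam * n by positivity)
    linarith
  have hNge : lam * n ≤ N := Nat.le_ceil _
  have hN0 : 0 < N := by
    have : (0 : ℝ) < N := by linarith
    exact_mod_cast this
  have h1 : cs * n < (blockCount n cs lam + 1) * N := by
    have h2 : ⌈cs * n⌉₊ < (blockCount n cs lam + 1) * N := by
      rw [mul_comm _ N]
      exact Nat.lt_mul_div_succ _ hN0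
    calc cs * n ≤ ⌈cs * n⌉₊ := Nat.le_ceil _
      _ < _ := by exact_mod_cast h2
  have h3 : cs < (2 * m + 1) * (2 * lam) := by
    have hm2 : (blockCount n cs lam : ℝ) ≤ 2 * m := by exact_mod_cast hm
    have : cs * n < (2 * m + 1) * (2 * lam) * n := by
      calc cs * n < (blockCount n cs lam + 1) * N := h1
        _ ≤ (2 * m + 1) * (2 * (lam * n)) := by gcongr
        _ = _ := by ring
    exact lt_of_mul_lt_mul_right this hn'.le
  have hmN : m * N ≤ n := by
    calc m * N ≤ blockCount n cs lam * N := Nat.mul_le_mul_right _ hm'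
      _ ≤ ⌈cs * n⌉₊ := Nat.div_mul_le_self _ _
      _ ≤ n := by
        refine Nat.ceil_le.2 ?_
        nlinarith
  -- The bound `h3` with `lam < cs / 8` gives `4 lam m > cs - 2 lam > 3 cs / 4`, which is more than
  -- needed.
  refine ⟨by nlinarith, hmN, ?_, ?_⟩
  · have h4 : lam * m * n ≤ 1 * n := by
      calc lam * m * n = m * (lam * n) := by ring
        _ ≤ m * N := by gcongr
        _ ≤ 1 * n := by rw [one_mul]; exact_mod_cast hmN
    exact le_of_mul_le_mul_right h4 hn'
  · have h5 : 2 * (N : ℝ) ≤ n := by nlinarith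
    have h6 : 2 * N ≤ n := by exact_mod_cast h5
    omega

/-! ### Assembly and choice of constants -/

lemma small_ball_of_levelSet {Ω Ω' : Type*} [MeasurableSpace Ω] [MeasurableSpace Ω']
    {n : ℕ} {A : Ω → Matrix (Fin n) (Fin n) ℝ} {μ : Measure Ω} [IsProbabilityMeasure μ]
    {ξ : Ω' → ℝ} {P : Measure Ω'} [IsProbabilityMeasure P] (hξ : AEMeasurable ξ P)
    (hA : IsSymmetricRandomMatrix A μ ξ P) {L c₀ c₁ cs lam : ℝ} (hL : 1 ≤ L)
    (hν : 1 ≤ L ^ 2 * ((P.map ξ).prod (P.map ξ)).real (moderatePairs L))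
    (hc₀ : 0 < c₀) (hc₁ : c₁ ∈ Set.Ioo (0 : ℝ) 1) (hcs : cs ∈ Set.Ioo (0 : ℝ) (1 / 5))
    (hn : 0 < n) (hlam1 : 1 ≤ lam * n) (hlamL : 128 * L ^ 2 / (c₁ ^ 2 * c₀) ≤ lam * n)
    (hlam : lam < cs / 8) (S : SpreadChoice n c₀ c₁ cs lam) {D : ℝ} (hD : 1 ≤ D)
    {v : EuclideanSpace ℝ (Fin n)} (hv : v ∈ levelSet S L D) (u : EuclideanSpace ℝ (Fin n))
    (K : ℝ) :
    μ.real {ω | ‖Matrix.toEuclideanLin (A ω) v - u‖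
        ≤ K * (L * √(Real.log (2 * D)) / D) * √n}
      ≤ (Real.exp (K ^ 2 + 1) * (40 * L * (L * √(Real.log (2 * D)) / D) / c₁ / √(cs / 8)))
          ^ (n - ⌈lam * n⌉₊) := by
  have := Measure.isProbabilityMeasure_map hξ
  obtain ⟨m, G, hTm, hmT, hdisj, hG⟩ := exists_blocks_of_mem_levelSet S hv
  obtain ⟨lev, hlev, hlevG⟩ := exists_level m G hdisj
  obtain ⟨hml, hmN, hlm1, hnN⟩ := block_numerics hn hcs.1 hcs.2 hlam1 hlam hTm hmT
  have hn' : (0 : ℝ) < n := by exact_mod_cast hn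
  have hl0 : 0 < lam := pos_of_mul_pos_left (by linarith) hn'.le
  have hm0 : 0 < m := by
    rcases Nat.eq_zero_or_pos m with rfl | h
    · have := hcs.1
      simp at hml
      linarith
    · exact h
  have hD0 : 0 < D := by linarith
  have hlog : 1 / 4 ≤ Real.log (2 * D) := by
    have : Real.log 2 ≤ Real.log (2 * D) := Real.log_le_log (by norm_num) (by linarith)
    linarith [Real.log_two_gt_d9]
  set β := L * √(Real.log (2 * D)) / D with hβ
  have hβ0 : 0 < β := by
    have : 0 < √(Real.log (2 * D)) := Real.sqrt_pos.2 (by linarith)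
    positivity
  -- The Gaussian tail `1 / D` is absorbed into the main term; `D ≥ 1` keeps `log (2 D)` away from
  -- zero.
  have hDβ : 1 / D ≤ 2 * (L * β) := by
    have h1 : 1 / 2 ≤ √(Real.log (2 * D)) := Real.le_sqrt_of_sq_le (by linarith)
    have h2 : 1 ≤ 2 * (L * (L * √(Real.log (2 * D)))) := by nlinarith
    calc 1 / D ≤ 2 * (L * (L * √(Real.log (2 * D)))) / D := by gcongr
      _ = _ := by rw [hβ]; ring
  -- The constant `40` covers `26 * 1.42 + 2`: the main term with `√2 ≤ 1.42`, plus the absorbed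
  -- tail.
  set a := 40 * L * β / c₁ with ha
  have ha0 : 0 ≤ a := div_nonneg (by positivity) hc₁.1.le
  set R : Finset (Fin n) := {k | 1 ≤ lev k} with hR
  have hRc : R.card = n - ⌈lam * n⌉₊ := by
    have : R = (G 0)ᶜ := by
      ext k
      rw [Finset.mem_compl, ← hlevG 0 hm0 k, hR, Finset.mem_filter]
      simp [Nat.one_le_iff_ne_zero]
    rw [this, Finset.card_compl, Fintype.card_fin, (hG 0 hm0).2.1]
  have hcardj : ∀ j < m, 1 ≤ j → {k ∈ R | lev k = j}.card ≤ ⌈lam * n⌉₊ := by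
    intro j hj _
    rw [← (hG j hj).2.1]
    refine Finset.card_le_card fun k hk => ?_
    exact (hlevG j hj k).1 (Finset.mem_filter.1 hk).2
  have hrow : ∀ k ∈ R, ∫ s, ∏ i with lev i < lev k, ‖charFun (P.map ξ) (s * (v i / β))‖
      ∂(gaussianReal 0 1) ≤ a / √(lam * lev k) := by
    intro k hk
    have hk1 : 1 ≤ lev k := (Finset.mem_filter.1 hk).2
    have hk0 : (0 : ℝ) < lev k := by exact_mod_cast hk1
    have hunion : (Finset.univ.filter fun i => lev i < lev k)
        = (Finset.range (lev k)).biUnion G := by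
      ext i
      simp only [Finset.mem_filter, Finset.mem_univ, true_and, Finset.mem_biUnion,
        Finset.mem_range]
      constructor
      · intro h
        exact ⟨lev i, h, (hlevG _ (h.trans_le (hlev k)) i).1 rfl⟩
      · rintro ⟨j, hj, hi⟩
        rwa [(hlevG j (hj.trans_le (hlev k)) i).2 hi]
    have hjm : ∀ j ∈ Finset.range (lev k), j < m := fun j hj =>
      (Finset.mem_range.1 hj).trans_le (hlev k)
    have hbd : ∀ j ∈ Finset.range (lev k), ∀ i ∈ G j,
        c₁ / √(2 * n) ≤ |v i| ∧ |v i| ≤ 1 / √(c₀ * n) := fun j hj i hi =>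
      S.spread_bounds v hv.1 i ((hG j (hjm j hj)).1 hi)
    rw [hunion]
    refine (integral_prod_charFun_blocks_le (P.map ξ) hL hD hν (r := c₁ * √(lam / 2))
      (mul_pos hc₁.1 (Real.sqrt_pos.2 (by positivity))) (Finset.range (lev k))
      (Finset.nonempty_range_iff.2 (by omega)) G ?_ ?_ ?_ ?_ ?_).trans ?_
    · intro i hi j hj hij
      exact hdisj i (hjm i hi) j (hjm j hj) hij
    · exact fun j hj => le_norm_restrictCoords hn hc₁.1 hl0 (hG j (hjm j hj)).2.1
        fun i hi => (hbd j hj i hi).1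
    · exact fun j hj => (norm_restrictCoords_le v _).trans_eq hv.1.1
    · exact fun j hj i hi => abs_le_of_spread hn hc₀ hc₁.1 (by linarith) hlamL (hbd j hj i hi).2
    · exact fun j hj => (hG j (hjm j hj)).2.2
    · rw [Finset.card_range, ← hβ]
      set σ := √(lam * lev k) with hσ
      have hσ0 : 0 < σ := Real.sqrt_pos.2 (by positivity)
      have hσ1 : σ ≤ 1 := by
        refine Real.sqrt_le_one.2 ?_
        refine le_trans ?_ hlm1
        gcongr
        exact hlev k
      have h1 : c₁ * √(lam / 2) * √(lev k) = c₁ * σ / √2 := by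
        rw [hσ, Real.sqrt_div hl0.le, Real.sqrt_mul hl0.le]
        ring
      have h2 : √2 ≤ 1.42 := Real.sqrt_le_iff.2 ⟨by norm_num, by norm_num⟩
      have hLβ : 0 < L * β := by positivity
      have hc := hc₁.1
      rw [h1]
      calc 26 * L * β / (c₁ * σ / √2) + 1 / D
          = 26 * (L * β) * √2 / (c₁ * σ) + 1 / D := by
            congr 1
            field_simp
        _ ≤ 26 * (L * β) * 1.42 / (c₁ * σ) + 2 * (L * β) / (c₁ * σ) := by
            refine add_le_add (by gcongr) (hDβ.trans ?_)
            rw [le_div_iff₀ (by positivity)]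
            refine mul_le_of_le_one_right (by positivity) ?_
            exact mul_le_one₀ hc₁.2.le hσ0.le hσ1
        _ ≤ a / σ := by
            rw [← add_div, ha, div_div]
            gcongr
            nlinarith
  refine (measureReal_norm_le hξ hA v u lev (fun k => a / √(lam * lev k)) R hβ0
    (fun k _ => by positivity) hrow).trans ?_
  have hprod := prod_div_sqrt_level_le R lev ha0 (by linarith [hcs.1] : 0 < cs / 8) hml hmN
    (fun k _ => hlev k) (fun k hk => (Finset.mem_filter.1 hk).2) hcardj
  have hKn : (K * β * √n / β) ^ 2 / 2 = K ^ 2 * (n / 2) := by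
    rw [mul_right_comm, mul_div_cancel_right₀ _ hβ0.ne', mul_pow, Real.sq_sqrt hn'.le]
    ring
  rw [hKn]
  calc Real.exp (K ^ 2 * (n / 2)) * ∏ k ∈ R, a / √(lam * lev k)
      ≤ Real.exp (K ^ 2 * (n / 2)) * ((a / √(cs / 8)) ^ R.card * Real.exp (n / 2)) := by
        gcongr
    _ = Real.exp ((K ^ 2 + 1) * (n / 2)) * (a / √(cs / 8)) ^ R.card := by
        rw [add_mul, Real.exp_add, one_mul]
        ring
    -- Since `n ≤ 2 |R|`, the factors exponential in `n` become factors per retained row.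
    _ ≤ Real.exp ((K ^ 2 + 1) * R.card) * (a / √(cs / 8)) ^ R.card := by
        gcongr
        have : (n : ℝ) ≤ 2 * R.card := by
          rw [hRc]
          exact_mod_cast hnN
        linarith
    _ = _ := by
        rw [mul_pow, ← Real.exp_nat_mul, hRc, mul_comm (K ^ 2 + 1)]

end SmallBall

end

theorem mainTheorem9 (B : ℝ≥0) :
    ∃ L : ℝ, 1 ≤ L ∧
    ∀ c₀ ∈ Set.Ioo (0 : ℝ) 1, ∀ c₁ ∈ Set.Ioo (0 : ℝ) 1, ∀ cs ∈ Set.Ioo (0 : ℝ) (1 / 5),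
    ∃ c : ℝ, 0 < c ∧ c ≤ cs / 2 ∧
    ∀ K : ℝ, 1 ≤ K →
    ∃ C : ℝ, 0 < C ∧
    ∀ {Ω' : Type*} [MeasurableSpace Ω'] (P : Measure Ω') [IsProbabilityMeasure P] (ξ : Ω' → ℝ),
      AEMeasurable ξ P → P[ξ] = 0 → Var[ξ; P] = 1 → SmallBall.subGaussianNorm ξ P ≤ B →
    ∀ {Ω : Type*} [MeasurableSpace Ω] (μ : Measure Ω) [IsProbabilityMeasure μ]
      (n : ℕ) (A : Ω → Matrix (Fin n) (Fin n) ℝ),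
      SmallBall.IsSymmetricRandomMatrix A μ ξ P →
    ∀ lam : ℝ, C / n < lam → lam < c →
    ∀ (S : SmallBall.SpreadChoice n c₀ c₁ cs lam) (D : ℝ), 1 ≤ D →
    ∀ v ∈ SmallBall.levelSet S L D, ∀ u : EuclideanSpace ℝ (Fin n),
      μ.real {ω | ‖Matrix.toEuclideanLin (A ω) v - u‖
          ≤ K * (L * √(Real.log (2 * D)) / D) * √n}
        ≤ (C * L ^ 2 * √(Real.log (2 * D)) / D) ^ (n - ⌈lam * n⌉₊) := by
  have hB : (0 : ℝ) ≤ B := B.2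
  -- The slack in `B + 1` provides an admissible `t < B + 1` in the infimum defining the norm; `L ≥
  -- 12 t²` is what the fourth moment argument requires.
  obtain ⟨L, hLdef⟩ : ∃ L : ℝ, L = 12 * ((B : ℝ) + 1) ^ 2 := ⟨_, rfl⟩
  have hL : 1 ≤ L := by rw [hLdef]; nlinarith
  refine ⟨L, hL, fun c₀ hc₀ c₁ hc₁ cs hcs => ⟨cs / 8, by linarith [hcs.1],
    by linarith [hcs.1], fun K _ => ?_⟩⟩
  have h0 : 0 < c₀ := hc₀.1
  have h1 : 0 < c₁ := hc₁.1
  have hs : 0 < √(cs / 8) := Real.sqrt_pos.2 (by linarith [hcs.1])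
  set C₁ := Real.exp (K ^ 2 + 1) * (40 / c₁ / √(cs / 8)) with hC₁
  have hC₁0 : 0 < C₁ := by positivity
  set C₂ := 128 * L ^ 2 / (c₁ ^ 2 * c₀) with hC₂
  have hC₂0 : 0 < C₂ := by positivity
  -- The summand `1` ensures `lam n ≥ 1`, `C₁` is the base of the final power, and `C₂` makes the
  -- coordinates in a block small relative to the norm of the block.
  refine ⟨1 + C₁ + C₂, by positivity, ?_⟩
  intro Ω' _ P _ ξ hξ hmean hvar hsub Ω _ μ _ n A hA lam hlamC hlamc S D hD v hv u
  have hn : 0 < n := by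
    rcases Nat.eq_zero_or_pos n with rfl | h
    · have h2 : ‖v‖ = 1 := hv.1.1
      rw [Subsingleton.elim v 0, norm_zero] at h2
      exact absurd h2 zero_ne_one
    · exact h
  have hn' : (0 : ℝ) < n := by exact_mod_cast hn
  rw [div_lt_iff₀ hn'] at hlamC
  have := Measure.isProbabilityMeasure_map hξ
  obtain ⟨t, ht0, htB, ht⟩ := SmallBall.exists_lt_of_subGaussianNorm_lt (b := (B : ℝ) + 1)
    (hsub.trans_lt (by
      rw [← ENNReal.ofReal_coe_nnreal, ENNReal.ofReal_lt_ofReal_iff (by positivity)]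
      linarith))
  have hν := SmallBall.one_le_mul_measureReal_moderatePairs (ν := P.map ξ) (t := t) (L := L)
    (by rw [hLdef]; gcongr) (by rwa [integral_map hξ (by fun_prop)])
    (by
      rw [integral_map hξ (by fun_prop), ← hvar, variance_eq_integral hξ, hmean]
      simp)
    ht0 (by rwa [lintegral_map' (by fun_prop) hξ])
  refine (SmallBall.small_ball_of_levelSet hξ hA hL hν h0 hc₁ hcs hn (by linarith)
    (by linarith) hlamc S hD hv u K).trans ?_
  have hD0 : 0 < D := by linarith
  refine pow_le_pow_left₀ (by positivity) ?_ _
  calc Real.exp (K ^ 2 + 1) * (40 * L * (L * √(Real.log (2 * D)) / D) / c₁ / √(cs / 8))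
      = C₁ * L ^ 2 * √(Real.log (2 * D)) / D := by rw [hC₁]; ring
    _ ≤ (1 + C₁ + C₂) * L ^ 2 * √(Real.log (2 * D)) / D := by
        gcongr
        linarith
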